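/- Let $M^2$ be a (non-empty) smooth 2-manifold with an equi-affine structure $(D,\Omega)$: $D$ is a smooth affine connection on $M^2$, possibly with torsion, and $\Omega$ is a smooth, nowhere vanishing 2-form on $M^2$ with $D\Omega=0$; $M^2$ carries the orientation for which $\Omega$ is positive. Write $[v,w]:=\Omega(v,w)$ for $v,w\in T_pM^2$. For a smooth curve $\gamma(t)$ in $M^2$ put $\dot\gamma=d\gamma/dt$, $\ddot\gamma=D_t\dot\gamma$, $\gamma^{(3)}=D_t\ddot\gamma$, $\gamma^{(4)}=D_t\gamma^{(3)}$, where $D_t$ is the covariant derivative along $\gamma$. A smooth curve $\gamma$ in $M^2$, defined near $t=0$, has a *3/2-cusp* at $t=0$ if there are a smooth coordinate change $t=t(s)$ near $0$ with $t(0)=0$ and a local diffeomorphism $\Phi$ from a neighbourhood of $\gamma(0)$ in $M^2$ into $\mathbf{R}^2$ such that $\Phi(\gamma(t(s)))=(s^2,s^3)$ for all $s$ near $0$. Let $S_0^*(\mathbf{R},M^2)$ be the set of germs at $t=0$ of such curves. For a curve with a 3/2-cusp at $t=0$ define, for small $t$ (with $t\neq 0$ in the case of $\kappa_A$), $$s_A(t)=\int_0^t\bigl|[\dot\gamma(u),\ddot\gamma(u)]\bigr|^{1/3}\,du,\qquad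 \kappa_A=\frac{3[\dot\gamma,\ddot\gamma][\dot\gamma,\gamma^{(4)}]+12[\dot\gamma,\ddot\gamma][\ddot\gamma,\gamma^{(3)}]-5[\dot\gamma,\gamma^{(3)}]^2}{9\,\bigl|[\dot\gamma,\ddot\gamma]\bigr|^{8/3}} .$$ Let $C_0^\infty(\mathbf{R})$ be the set of germs at $t=0$ of real-valued $C^\infty$ functions. Then for every $\gamma\in S_0^*(\mathbf{R},M^2)$ the function $s_A(t)^2\kappa_A(t)$, extended to $t=0$ by its limit, defines an element $\mathcal{F}_A(\gamma)$ of $C_0^\infty(\mathbf{R})$, and the image of the resulting map $\mathcal{F}_A:S_0^*(\mathbf{R},M^2)\to C_0^\infty(\mathbf{R})$ is $$\Sigma_A=\Bigl\{f\in C_0^\infty(\mathbf{R}) : f(0)=\tfrac{4}{25},\ \dot f(0)=0\Bigr\}.$$ -/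

import Mathlib

open Filter Topology Bundle
open scoped Manifold ContDiff

/-- The model plane `ℝ²` of the charts. -/
abbrev Plane : Type := EuclideanSpace ℝ (Fin 2)

/-! ### Germs of 3/2-cusps -/

section Cusps

variable {M : Type*} [TopologicalSpace M] [ChartedSpace Plane M]

/-- The curve `γ` is smooth near `t = 0` and has a 3/2-cusp there: after a smooth change `c` of
the parameter near `0` and composition with a local diffeomorphism `Φ` of `M` at `γ 0` into `ℝ²`,
it becomes `s ↦ (s ^ 2, s ^ 3)`. -/
def IsThreeHalvesCusp (γ : ℝ → M) : Prop :=
  (∀ᶠ t in 𝓝 (0 : ℝ), ContMDiffAt 𝓘(ℝ, ℝ) (𝓡 2) ∞ γ t) ∧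
    ∃ (c : ℝ → ℝ) (Φ : M → ℝ × ℝ),
      c 0 = 0 ∧ IsLocalDiffeomorphAt 𝓘(ℝ, ℝ) 𝓘(ℝ, ℝ) ∞ c 0 ∧
      IsLocalDiffeomorphAt (𝓡 2) 𝓘(ℝ, ℝ × ℝ) ∞ Φ (γ 0) ∧
      ∀ᶠ s in 𝓝 (0 : ℝ), Φ (γ (c s)) = (s ^ 2, s ^ 3)

variable (M) in
/-- The set of germs at `t = 0` of smooth curves in `M` that have a 3/2-cusp at `t = 0`. -/
def cuspGerms : Set (Germ (𝓝 (0 : ℝ)) M) :=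
  {g | ∃ γ : ℝ → M, IsThreeHalvesCusp γ ∧ (γ : Germ (𝓝 (0 : ℝ)) M) = g}

/-- The velocity `γ'(t)` of a curve. -/
noncomputable def velocity (γ : ℝ → M) (t : ℝ) : TangentSpace (𝓡 2) (γ t) :=
  mfderiv 𝓘(ℝ, ℝ) (𝓡 2) γ t (1 : ℝ)

theorem velocity_congr {γ δ : ℝ → M} {t : ℝ} (h : γ =ᶠ[𝓝 t] δ) :
    TotalSpace.mk' Plane (E := fun q : M ↦ TangentSpace (𝓡 2) q) (γ t) (velocity γ t) =
      TotalSpace.mk' Plane (δ t) (velocity δ t) := by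
  have h1 : γ t = δ t := h.eq_of_nhds
  have h2 := h.mfderiv_eq (I := 𝓘(ℝ, ℝ)) (I' := 𝓡 2)
  have h3 : HEq (velocity γ t) (velocity δ t) := heq_of_eq (by
    unfold velocity
    exact congrArg (fun (L : ℝ →L[ℝ] Plane) ↦ L 1) h2)
  exact Bundle.TotalSpace.ext h1 h3

end Cusps

/-! ### Equi-affine surfaces -/

/-- An equi-affine structure on a smooth surface `M`: a smooth affine connection `D` (torsion is
allowed) and a smooth nowhere vanishing 2-form `Ω` that is parallel with respect to `D`.
The orientation of `M` is the one for which `Ω` is positive. -/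
structure EquiAffineStructure (M : Type*) [TopologicalSpace M] [ChartedSpace Plane M]
    [IsManifold (𝓡 2) ∞ M] where
  /-- The connection: `D Y p v` is the covariant derivative of `Y` at `p` in direction `v`. -/
  D : CovariantDerivative (𝓡 2) Plane (fun p : M ↦ TangentSpace (𝓡 2) p)
  smooth_D : CovariantDerivative.ContMDiffCovariantDerivative D ∞
  /-- The area form; `Ω p v w` is the bracket `[v, w]`. -/
  Ω : ∀ p : M, TangentSpace (𝓡 2) p →L[ℝ] TangentSpace (𝓡 2) p →L[ℝ] ℝ
  smooth_Ω : ContMDiff (𝓡 2) ((𝓡 2).prod 𝓘(ℝ, Plane →L[ℝ] Plane →L[ℝ] ℝ)) ∞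
    (fun p ↦ TotalSpace.mk' (Plane →L[ℝ] Plane →L[ℝ] ℝ) p (Ω p))
  alternating : ∀ (p : M) (v : TangentSpace (𝓡 2) p), Ω p v v = 0
  nonvanishing : ∀ p : M, Ω p ≠ 0
  /-- `v (Ω(X, Y)) = Ω(D_v X, Y) + Ω(X, D_v Y)`, that is, `DΩ = 0`. -/
  parallel : ∀ (p : M) (X Y : ∀ q : M, TangentSpace (𝓡 2) q),
    MDifferentiableAt (𝓡 2) ((𝓡 2).prod 𝓘(ℝ, Plane)) (fun q ↦ TotalSpace.mk' Plane q (X q)) p →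
    MDifferentiableAt (𝓡 2) ((𝓡 2).prod 𝓘(ℝ, Plane)) (fun q ↦ TotalSpace.mk' Plane q (Y q)) p →
    ∀ v : TangentSpace (𝓡 2) p,
      mvfderiv (𝓡 2) (fun q ↦ Ω q (X q) (Y q)) p v = Ω p (D X p v) (Y p) + Ω p (X p) (D Y p v)

namespace EquiAffineStructure

variable {M : Type*} [TopologicalSpace M] [ChartedSpace Plane M] [IsManifold (𝓡 2) ∞ M]
  (S : EquiAffineStructure M)

/-- Auxiliary: the tangent vector at `p` with coordinates `d` in the local frame `(eᵢ)` of `TM`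
given by the preferred trivialization at `p`, plus the covariant derivative in direction `v` of the
extension of `x` with constant coordinates in that frame. -/
noncomputable def covDerivAux (p : M) (x v : TangentSpace (𝓡 2) p) (d : Plane) :
    TangentSpace (𝓡 2) p :=
  (trivializationAt Plane (fun q : M ↦ TangentSpace (𝓡 2) q) p).symm p d +
    S.D (FiberBundle.extend Plane x) p v

/-- The covariant derivative `D_t X` of a vector field `X` along the curve `γ`. If `X = ∑ Xⁱ eᵢ`
in the local frame `(eᵢ)` of `TM` given by the preferred trivialization at `γ t`, this is
`∑ (Xⁱ)'(t) eᵢ + D_{γ'(t)} (∑ Xⁱ(t) eᵢ)`. -/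
noncomputable def covDerivAlong (γ : ℝ → M) (X : ∀ t, TangentSpace (𝓡 2) (γ t)) (t : ℝ) :
    TangentSpace (𝓡 2) (γ t) :=
  S.covDerivAux (γ t) (X t) (velocity γ t)
    (deriv (fun u ↦ (trivializationAt Plane (fun q : M ↦ TangentSpace (𝓡 2) q) (γ t)
      ⟨γ u, X u⟩).2) t)

/-- `S.curveDeriv γ k` is the derivative of order `k + 1` of the curve `γ`: first the velocity,
then its iterated covariant derivatives along `γ`. -/
noncomputable def curveDeriv (γ : ℝ → M) : ℕ → ∀ t, TangentSpace (𝓡 2) (γ t)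
  | 0 => velocity γ
  | k + 1 => S.covDerivAlong γ (curveDeriv γ k)

/-- The bracket `[γ⁽ⁱ⁺¹⁾(t), γ⁽ʲ⁺¹⁾(t)]` of two derivatives of the curve. -/
noncomputable def bracket (γ : ℝ → M) (i j : ℕ) (t : ℝ) : ℝ :=
  S.Ω (γ t) (S.curveDeriv γ i t) (S.curveDeriv γ j t)

/-- The affine curvature
`(3[γ', γ''][γ', γ⁽⁴⁾] + 12[γ', γ''][γ'', γ⁽³⁾] - 5[γ', γ⁽³⁾]²) / (9 |[γ', γ'']|^(8/3))`. -/
noncomputable def affineCurvature (γ : ℝ → M) (t : ℝ) : ℝ :=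
  (3 * S.bracket γ 0 1 t * S.bracket γ 0 3 t + 12 * S.bracket γ 0 1 t * S.bracket γ 1 2 t
      - 5 * S.bracket γ 0 2 t ^ 2) /
    (9 * |S.bracket γ 0 1 t| ^ (8 / 3 : ℝ))

/-- The affine arclength `∫₀ᵗ |[γ'(u), γ''(u)]|^(1/3) du`. -/
noncomputable def affineArclength (γ : ℝ → M) (t : ℝ) : ℝ :=
  ∫ u in (0 : ℝ)..t, |S.bracket γ 0 1 u| ^ (1 / 3 : ℝ)

/-- The normalized affine curvature `(s_A)² κ_A`, with its limit as the value at `t = 0`, where the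
affine curvature itself is undefined. -/
noncomputable def normalizedCurvature (γ : ℝ → M) : ℝ → ℝ :=
  Function.update (fun t ↦ S.affineArclength γ t ^ 2 * S.affineCurvature γ t) 0
    (limUnder (𝓝[≠] (0 : ℝ)) fun t ↦ S.affineArclength γ t ^ 2 * S.affineCurvature γ t)

/-! The normalized affine curvature depends only on the germ of the curve. -/

theorem covDerivAux_congr {p q : M} {x v : TangentSpace (𝓡 2) p} {y w : TangentSpace (𝓡 2) q}
    {d e : Plane}
    (hx : TotalSpace.mk' Plane (E := fun q : M ↦ TangentSpace (𝓡 2) q) p x = TotalSpace.mk' Plane q y)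
    (hv : TotalSpace.mk' Plane (E := fun q : M ↦ TangentSpace (𝓡 2) q) p v = TotalSpace.mk' Plane q w)
    (hd : d = e) :
    TotalSpace.mk' Plane (E := fun q : M ↦ TangentSpace (𝓡 2) q) p (S.covDerivAux p x v d) =
      TotalSpace.mk' Plane q (S.covDerivAux q y w e) := by
  cases hx
  cases hv
  rw [hd]

theorem curveDeriv_congr {γ δ : ℝ → M} (k : ℕ) {t : ℝ} (h : γ =ᶠ[𝓝 t] δ) :
    TotalSpace.mk' Plane (E := fun q : M ↦ TangentSpace (𝓡 2) q) (γ t) (S.curveDeriv γ k t) =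
      TotalSpace.mk' Plane (δ t) (S.curveDeriv δ k t) := by
  induction k generalizing t with
  | zero => exact velocity_congr h
  | succ k ih =>
    refine S.covDerivAux_congr (ih h) (velocity_congr h) (Filter.EventuallyEq.deriv_eq ?_)
    filter_upwards [h.eventually_nhds] with u hu
    have := ih hu
    rw [h.eq_of_nhds]
    exact congrArg (fun z ↦ (trivializationAt Plane
      (fun q : M ↦ TangentSpace (𝓡 2) q) (δ t) z).2) this

theorem bracket_congr {γ δ : ℝ → M} (i j : ℕ) {t : ℝ} (h : γ =ᶠ[𝓝 t] δ) :
    S.bracket γ i j t = S.bracket δ i j t := by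
  have key : ∀ {p q : M} {x v : TangentSpace (𝓡 2) p} {y w : TangentSpace (𝓡 2) q},
      TotalSpace.mk' Plane (E := fun q : M ↦ TangentSpace (𝓡 2) q) p x = TotalSpace.mk' Plane q y →
      TotalSpace.mk' Plane (E := fun q : M ↦ TangentSpace (𝓡 2) q) p v = TotalSpace.mk' Plane q w →
      S.Ω p x v = S.Ω q y w := by
    intro p q x v y w hx hv
    cases hx
    cases hv
    rfl
  exact key (S.curveDeriv_congr i h) (S.curveDeriv_congr j h)

theorem normalizedCurvature_congr {γ δ : ℝ → M} (h : γ =ᶠ[𝓝 (0 : ℝ)] δ) :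
    S.normalizedCurvature γ =ᶠ[𝓝 (0 : ℝ)] S.normalizedCurvature δ := by
  have h0 : ∀ᶠ t in 𝓝 (0 : ℝ), S.affineArclength γ t ^ 2 * S.affineCurvature γ t =
      S.affineArclength δ t ^ 2 * S.affineCurvature δ t := by
    obtain ⟨ε, hε, hb⟩ := Metric.eventually_nhds_iff.1 h.eventually_nhds
    refine Metric.eventually_nhds_iff.2 ⟨ε, hε, fun t ht ↦ ?_⟩
    have hbr : ∀ i j, ∀ u, dist u 0 < ε → S.bracket γ i j u = S.bracket δ i j u :=
      fun i j u hu ↦ S.bracket_congr i j (hb hu)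
    have hs : S.affineArclength γ t = S.affineArclength δ t := by
      refine intervalIntegral.integral_congr fun u hu ↦ ?_
      have hu' : dist u 0 < ε := by
        have := Set.abs_sub_left_of_mem_uIcc hu
        simp only [Real.dist_eq, sub_zero] at this ht ⊢
        exact this.trans_lt ht
      simp only [hbr 0 1 u hu']
    simp only [hs, affineCurvature, hbr _ _ t ht]
  have hl : (limUnder (𝓝[≠] (0 : ℝ)) fun t ↦ S.affineArclength γ t ^ 2 * S.affineCurvature γ t) =
      limUnder (𝓝[≠] (0 : ℝ)) fun t ↦ S.affineArclength δ t ^ 2 * S.affineCurvature δ t := by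
    unfold limUnder
    rw [Filter.map_congr (h0.filter_mono nhdsWithin_le_nhds)]
  filter_upwards [h0] with t ht
  by_cases h' : t = 0
  · subst h'
    simp [normalizedCurvature, hl]
  · simp [normalizedCurvature, h', ht]

/-- The map `F_A` on germs at `0` that sends the germ of a curve `γ` to the germ of its normalized
affine curvature `t ↦ s_A(t)² κ_A(t)`. -/
noncomputable def normalizedCurvatureGerm (g : Germ (𝓝 (0 : ℝ)) M) : Germ (𝓝 (0 : ℝ)) ℝ :=
  g.map' S.normalizedCurvature fun _ _ h ↦ S.normalizedCurvature_congr h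

end EquiAffineStructure

/-! A 3/2-cusp is the same thing as a curve whose velocity in a chart is `t • Y t`, with `Y 0` and
the derivative of `Y` at `0` linearly independent. One direction is the chain rule applied to `(σ ^
2, σ ^ 3)`. The other is a normal form: integrate to `x = x 0 + t ^ 2 • y`, change the parameter so
that one coordinate becomes `s ^ 2`, and straighten the other with Whitney's theorem on even
functions (`exists_cusp_normal_form`).

Put `w = [Y, ∇Y]` and `u = |w| ^ (1/3)`. Differentiating `t • Y` covariantly gives `[γ', γ''] = t ^
2 * w` and similar formulas for the other brackets. Substituting `r * t` in the arclength integral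
gives `s_A = t * |t| ^ (2/3) * σ`, where `σ` is the smooth average of `u` with weight `r ^ (2/3)`.
All powers of `|t|` then cancel in `s_A ^ 2 * κ_A`, leaving the smooth function `σ ^ 2 * (4 * w ^ 2
+ t * w * [Y, ∇∇Y] + t ^ 2 * E) / (9 * u ^ 8)`. Since `Ω` is parallel, `[Y, ∇∇Y] = w'`. With `σ 0 =
3/5 * u 0` the value at `0` is `4/25`. The logarithmic derivative at `0` is `u'/u` times `5/4 + 27/4
- 8 = 0`. This is the inclusion `normalizedCurvature_of_cusp`.

Conversely, write `f = 4/25 + t ^ 2 * k` and let `q = 25/9 * k`. Solve the ODE `x' = t • Y`, `∇∇Y =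
-q • Y` with `[Y, ∇Y] = 1` at the start. The area `[Y, ∇Y]` stays `1`, so `x` has a cusp, and the
formula above becomes `4/25 + 9/25 * t ^ 2 * q = f` (`exists_cusp_of_oneJet`). Only derivatives
along a single curve occur, so torsion plays no role. -/

/-! ### Tangent vectors and covariant derivatives in chart coordinates. -/

section Coordinates

variable {M : Type*} [TopologicalSpace M] [ChartedSpace Plane M] [IsManifold (𝓡 2) ∞ M]

/-- The coordinates of a tangent vector at `q` in the preferred trivialization at `p`. -/
noncomputable def tangentCoord (p q : M) : TangentSpace (𝓡 2) q →L[ℝ] Plane :=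
  (trivializationAt Plane (fun q : M ↦ TangentSpace (𝓡 2) q) p).continuousLinearMapAt ℝ q

/-- The vector field with constant coordinates in the preferred trivialization at `p`. -/
noncomputable def constSection (p : M) (d : Plane) (q : M) : TangentSpace (𝓡 2) q :=
  (trivializationAt Plane (fun q : M ↦ TangentSpace (𝓡 2) q) p).symmL ℝ q d

variable {p q : M}

theorem tangentCoord_constSection (h : q ∈ (chartAt Plane p).source) (d : Plane) :
    tangentCoord p q (constSection p d q) = d :=
  Trivialization.continuousLinearMapAt_symmL _ (by simpa using h) d

theorem constSection_tangentCoord (h : q ∈ (chartAt Plane p).source) (v : TangentSpace (𝓡 2) q) :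
    constSection p (tangentCoord p q v) q = v :=
  Trivialization.symmL_continuousLinearMapAt _ (by simpa using h) v

theorem trivializationAt_snd (h : q ∈ (chartAt Plane p).source) (v : TangentSpace (𝓡 2) q) :
    (trivializationAt Plane (fun q : M ↦ TangentSpace (𝓡 2) q) p ⟨q, v⟩).2 =
      tangentCoord p q v := by
  rw [tangentCoord, Trivialization.continuousLinearMapAt_apply,
    Trivialization.coe_linearMapAt_of_mem _ (by simpa using h)]

theorem constSection_add (p : M) (d d' : Plane) :
    constSection p (d + d') = constSection p d + constSection p d' := by
  ext1 q
  exact map_add _ d d'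

theorem constSection_smul (p : M) (a : ℝ) (d : Plane) :
    constSection p (a • d) = a • constSection p d := by
  ext1 q
  exact map_smul _ a d

theorem contMDiffAt_section_iff_tangentCoord (h : q ∈ (chartAt Plane p).source)
    {Y : ∀ q : M, TangentSpace (𝓡 2) q} {n : WithTop ℕ∞}
    [ContMDiffVectorBundle n Plane (fun p : M ↦ TangentSpace (𝓡 2) p) (𝓡 2)] :
    ContMDiffAt (𝓡 2) ((𝓡 2).prod 𝓘(ℝ, Plane)) n (fun q ↦ TotalSpace.mk' Plane q (Y q)) q ↔
      ContMDiffAt (𝓡 2) 𝓘(ℝ, Plane) n (fun q ↦ tangentCoord p q (Y q)) q := by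
  rw [Trivialization.contMDiffAt_section_iff
    (trivializationAt Plane (fun q : M ↦ TangentSpace (𝓡 2) q) p) (by simpa using h)]
  refine Filter.EventuallyEq.contMDiffAt_iff ?_
  filter_upwards [(chartAt Plane p).open_source.mem_nhds h] with q' hq'
  exact trivializationAt_snd hq' _

theorem mdifferentiableAt_section_iff_tangentCoord (h : q ∈ (chartAt Plane p).source)
    {Y : ∀ q : M, TangentSpace (𝓡 2) q} :
    MDifferentiableAt (𝓡 2) ((𝓡 2).prod 𝓘(ℝ, Plane)) (fun q ↦ TotalSpace.mk' Plane q (Y q)) q ↔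
      MDifferentiableAt (𝓡 2) 𝓘(ℝ, Plane) (fun q ↦ tangentCoord p q (Y q)) q := by
  rw [Trivialization.mdifferentiableAt_section_iff (𝓡 2)
    (trivializationAt Plane (fun q : M ↦ TangentSpace (𝓡 2) q) p) Y (by simpa using h)]
  refine Filter.EventuallyEq.mdifferentiableAt_iff ?_
  filter_upwards [(chartAt Plane p).open_source.mem_nhds h] with q' hq'
  exact trivializationAt_snd hq' _

theorem contMDiffAt_constSection (h : q ∈ (chartAt Plane p).source) (d : Plane) :
    ContMDiffAt (𝓡 2) ((𝓡 2).prod 𝓘(ℝ, Plane)) ∞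
      (fun q ↦ TotalSpace.mk' Plane q (constSection p d q)) q := by
  rw [contMDiffAt_section_iff_tangentCoord h]
  refine (contMDiffAt_const (c := d)).congr_of_eventuallyEq ?_
  filter_upwards [(chartAt Plane p).open_source.mem_nhds h] with q' hq'
  exact tangentCoord_constSection hq' d

theorem mdifferentiableAt_constSection (h : q ∈ (chartAt Plane p).source) (d : Plane) :
    MDifferentiableAt (𝓡 2) ((𝓡 2).prod 𝓘(ℝ, Plane))
      (fun q ↦ TotalSpace.mk' Plane q (constSection p d q)) q :=
  (contMDiffAt_constSection h d).mdifferentiableAt (by simp)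

theorem plane_eq_sum (d : Plane) :
    d = d 0 • EuclideanSpace.single (0 : Fin 2) (1 : ℝ) + d 1 • EuclideanSpace.single 1 1 := by
  ext i
  fin_cases i <;> simp

theorem tangentCoord_velocity {γ : ℝ → M} {t : ℝ} (h : γ t ∈ (chartAt Plane p).source)
    (hγ : MDifferentiableAt 𝓘(ℝ, ℝ) (𝓡 2) γ t) :
    tangentCoord p (γ t) (velocity γ t) = deriv (fun u ↦ extChartAt (𝓡 2) p (γ u)) t := by
  have h1 := TangentBundle.continuousLinearMapAt_trivializationAt (I := 𝓡 2) h
  have h2 : MDifferentiableAt (𝓡 2) 𝓘(ℝ, Plane) (extChartAt (𝓡 2) p) (γ t) :=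
    mdifferentiableAt_extChartAt h
  have h3 := mfderiv_comp t h2 hγ
  unfold tangentCoord velocity
  rw [← fderiv_apply_one_eq_deriv, ← mfderiv_eq_fderiv]
  change _ = mfderiv 𝓘(ℝ, ℝ) 𝓘(ℝ, Plane) (extChartAt (𝓡 2) p ∘ γ) t 1
  rw [h3]
  exact congrArg (fun L : Plane →L[ℝ] Plane ↦ L _) h1

namespace EquiAffineStructure

variable (S : EquiAffineStructure M)

theorem D_constSection_add (h : q ∈ (chartAt Plane p).source) (d d' : Plane) :
    S.D (constSection p (d + d')) q = S.D (constSection p d) q + S.D (constSection p d') q := by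
  rw [constSection_add]
  exact S.D.isCovariantDerivativeOnUniv.add (mdifferentiableAt_constSection h d)
    (mdifferentiableAt_constSection h d')

theorem D_constSection_smul (h : q ∈ (chartAt Plane p).source) (a : ℝ) (d : Plane) :
    S.D (constSection p (a • d)) q = a • S.D (constSection p d) q := by
  rw [constSection_smul]
  exact S.D.isCovariantDerivativeOnUniv.smul_const a (mdifferentiableAt_constSection h d)

/-- A connection is local, and the two extensions of `x` agree on the chart domain at `q`. This
replaces the extension in the definition of `covDerivAux` by a frame field. -/
theorem D_extend (x : TangentSpace (𝓡 2) q) :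
    S.D (FiberBundle.extend Plane x) q = S.D (constSection q (tangentCoord q q x)) q := by
  have hq := mem_chart_source Plane q
  refine S.D.isCovariantDerivativeOnUniv.congr_of_eventuallyEq
    (FiberBundle.mdifferentiableAt_extend (𝓡 2) Plane x) (mdifferentiableAt_constSection hq _)
    univ_mem ?_
  filter_upwards [(chartAt Plane q).open_source.mem_nhds hq] with q' hq'
  rw [← trivializationAt_snd hq, constSection, Trivialization.symmL_apply _ (by simpa using hq')]
  rfl

theorem covDerivAux_eq (x v : TangentSpace (𝓡 2) q) (d : Plane) :
    S.covDerivAux q x v d =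
      constSection q d q + S.D (constSection q (tangentCoord q q x)) q v := by
  rw [covDerivAux, D_extend, constSection, Trivialization.symmL_apply _ (by simp)]

theorem covDerivAux_add (x y v : TangentSpace (𝓡 2) q) (d e : Plane) :
    S.covDerivAux q (x + y) v (d + e) = S.covDerivAux q x v d + S.covDerivAux q y v e := by
  rw [covDerivAux_eq, covDerivAux_eq, covDerivAux_eq, map_add,
    S.D_constSection_add (mem_chart_source Plane q), constSection_add, _root_.add_apply,
    Pi.add_apply]
  abel

theorem covDerivAux_smul (a : ℝ) (x v : TangentSpace (𝓡 2) q) (d : Plane) :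
    S.covDerivAux q (a • x) v (a • d) = a • S.covDerivAux q x v d := by
  rw [covDerivAux_eq, covDerivAux_eq, map_smul,
    S.D_constSection_smul (mem_chart_source Plane q), constSection_smul, _root_.smul_apply,
    Pi.smul_apply, smul_add]

theorem covDerivAux_zero_left (v : TangentSpace (𝓡 2) q) (d : Plane) :
    S.covDerivAux q 0 v d = constSection q d q := by
  have := S.D_constSection_smul (mem_chart_source Plane q) 0 0
  rw [covDerivAux_eq, map_zero]
  simp only [zero_smul] at this
  simp [this]

/-- Along the restriction of a vector field to a curve, the covariant derivative along the curve is
the covariant derivative of the field in the direction of the velocity. -/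
theorem covDerivAux_section {γ : ℝ → M} {t : ℝ} (hγ : MDifferentiableAt 𝓘(ℝ, ℝ) (𝓡 2) γ t)
    {Y : ∀ q : M, TangentSpace (𝓡 2) q}
    (hY : MDifferentiableAt (𝓡 2) ((𝓡 2).prod 𝓘(ℝ, Plane))
      (fun q ↦ TotalSpace.mk' Plane q (Y q)) (γ t)) :
    S.covDerivAux (γ t) (Y (γ t)) (velocity γ t)
      (deriv (fun u ↦ tangentCoord (γ t) (γ u) (Y (γ u))) t) = S.D Y (γ t) (velocity γ t) := by
  have hq := mem_chart_source Plane (γ t)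
  set q := γ t with hqt
  have hF := (mdifferentiableAt_section_iff_tangentCoord hq).1 hY
  set F : M → Plane := fun q' ↦ tangentCoord q q' (Y q') with hFdef
  have hFi : ∀ i : Fin 2, MDifferentiableAt (𝓡 2) 𝓘(ℝ, ℝ) (fun q' ↦ F q' i) q := fun i ↦
    ((EuclideanSpace.proj (𝕜 := ℝ) i : Plane →L[ℝ] ℝ).differentiableAt.mdifferentiableAt).comp
      (g := (EuclideanSpace.proj (𝕜 := ℝ) i : Plane →L[ℝ] ℝ)) q hF
  have hFd : ∀ i : Fin 2, mvfderiv (𝓡 2) (fun q' ↦ F q' i) q (velocity γ t) =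
      deriv (fun u ↦ F (γ u)) t i := by
    intro i
    have h1 : deriv (fun u ↦ F (γ u)) t = mfderiv 𝓘(ℝ, ℝ) 𝓘(ℝ, Plane) (F ∘ γ) t (1 : ℝ) := by
      rw [← fderiv_apply_one_eq_deriv, ← mfderiv_eq_fderiv]; rfl
    have h2 : MDifferentiableAt 𝓘(ℝ, ℝ) 𝓘(ℝ, Plane) (F ∘ γ) t := hF.comp t hγ
    have h3 : DifferentiableAt ℝ (fun u ↦ F (γ u)) t := h2.differentiableAt
    have h4 := mvfderiv_comp_apply (I := 𝓡 2) (I' := 𝓘(ℝ, ℝ)) t (hFi i) hγ (1 : ℝ)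
    unfold velocity
    rw [← h4]
    have h5 : HasDerivAt (fun u ↦ F (γ u) i) (deriv (fun u ↦ F (γ u)) t i) t :=
      ((EuclideanSpace.proj (𝕜 := ℝ) i : Plane →L[ℝ] ℝ).hasFDerivAt.comp_hasDerivAt t
        h3.hasDerivAt)
    rw [← h5.deriv, ← fderiv_apply_one_eq_deriv, ← mfderiv_eq_fderiv]
    rfl
  -- Near `q` the field is a combination of the frame with coefficient functions, so the Leibniz
  -- rule applies; the derivatives of the coefficients along the velocity are `hFd`.
  have hsum : S.D Y q = S.D ((fun q' ↦ F q' 0) • constSection q (EuclideanSpace.single 0 1) +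
      (fun q' ↦ F q' 1) • constSection q (EuclideanSpace.single 1 1)) q := by
    refine S.D.isCovariantDerivativeOnUniv.congr_of_eventuallyEq hY ?_ univ_mem ?_
    · exact mdifferentiableAt_add_section
        ((hFi 0).smul_section (mdifferentiableAt_constSection hq _))
        ((hFi 1).smul_section (mdifferentiableAt_constSection hq _))
    · filter_upwards [(chartAt Plane q).open_source.mem_nhds hq] with q' hq'
      rw [← constSection_tangentCoord hq' (Y q')]
      conv_lhs => rw [plane_eq_sum (tangentCoord q q' (Y q')), constSection_add,
        constSection_smul, constSection_smul]
      rfl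
  rw [hsum, S.D.isCovariantDerivativeOnUniv.add
      ((hFi 0).smul_section (mdifferentiableAt_constSection hq _))
      ((hFi 1).smul_section (mdifferentiableAt_constSection hq _)),
    S.D.isCovariantDerivativeOnUniv.leibniz (mdifferentiableAt_constSection hq _) (hFi 0),
    S.D.isCovariantDerivativeOnUniv.leibniz (mdifferentiableAt_constSection hq _) (hFi 1),
    covDerivAux_eq]
  change constSection q (deriv (fun u ↦ F (γ u)) t) q + S.D (constSection q (F q)) q _ = _
  rw [plane_eq_sum (F q), plane_eq_sum (deriv (fun u ↦ F (γ u)) t), S.D_constSection_add hq,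
    S.D_constSection_smul hq, S.D_constSection_smul hq, constSection_add, constSection_smul,
    constSection_smul]
  simp only [_root_.add_apply, _root_.smul_apply,
    ContinuousLinearMap.smulRight_apply, hFd, Pi.add_apply, Pi.smul_apply]
  simp
  abel

/-- The coordinates of `D_{E_j} E_i`, where `E` is the local frame given by the preferred
trivialization at `p`. -/
noncomputable def christoffel (p : M) (i j : Fin 2) (q : M) : Plane :=
  tangentCoord p q (S.D (constSection p (EuclideanSpace.single i 1)) q
    (constSection p (EuclideanSpace.single j 1) q))

/-- The value of the area form on the local frame given by the preferred trivialization at `p`. -/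
noncomputable def areaCoeff (p : M) (q : M) : ℝ :=
  S.Ω q (constSection p (EuclideanSpace.single 0 1) q) (constSection p (EuclideanSpace.single 1 1) q)

theorem tangentCoord_D (h : q ∈ (chartAt Plane p).source) (d : Plane)
    (v : TangentSpace (𝓡 2) q) :
    tangentCoord p q (S.D (constSection p d) q v) =
      ∑ i, ∑ j, (d i * tangentCoord p q v j) • S.christoffel p i j q := by
  conv_lhs => rw [plane_eq_sum d, S.D_constSection_add h, S.D_constSection_smul h,
    S.D_constSection_smul h, ← constSection_tangentCoord h v,
    plane_eq_sum (tangentCoord p q v), constSection_add, constSection_smul, constSection_smul]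
  simp only [_root_.add_apply, _root_.smul_apply, Pi.add_apply,
    Pi.smul_apply, map_add, map_smul, Fin.sum_univ_two, christoffel]
  module

theorem Ω_eq (h : q ∈ (chartAt Plane p).source) (v w : TangentSpace (𝓡 2) q) :
    S.Ω q v w = S.areaCoeff p q * (tangentCoord p q v 0 * tangentCoord p q w 1 -
      tangentCoord p q v 1 * tangentCoord p q w 0) := by
  have hs : ∀ x y : TangentSpace (𝓡 2) q, S.Ω q x y = - S.Ω q y x := by
    intro x y
    have := S.alternating q (x + y)
    simp only [map_add, _root_.add_apply, S.alternating, zero_add, add_zero] at this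
    linarith
  conv_lhs => rw [← constSection_tangentCoord h v, ← constSection_tangentCoord h w,
    plane_eq_sum (tangentCoord p q v), plane_eq_sum (tangentCoord p q w), constSection_add,
    constSection_add, constSection_smul, constSection_smul, constSection_smul, constSection_smul]
  simp only [Pi.add_apply, Pi.smul_apply, map_add, map_smul, _root_.add_apply,
    _root_.smul_apply, S.alternating, smul_eq_mul, areaCoeff]
  rw [hs (constSection p (EuclideanSpace.single 1 1) q)]
  ring

theorem areaCoeff_ne_zero (h : q ∈ (chartAt Plane p).source) : S.areaCoeff p q ≠ 0 := by
  intro h0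
  refine S.nonvanishing q ?_
  ext v w
  rw [S.Ω_eq h, h0]
  simp

/-- Coordinates of the covariant derivative along a curve, in the preferred trivialization at a
fixed point. -/
theorem tangentCoord_covDerivAlong {γ : ℝ → M} {t : ℝ} (h : γ t ∈ (chartAt Plane p).source)
    (hγ : MDifferentiableAt 𝓘(ℝ, ℝ) (𝓡 2) γ t) {X : ∀ t, TangentSpace (𝓡 2) (γ t)}
    (hX : DifferentiableAt ℝ (fun u ↦ tangentCoord p (γ u) (X u)) t) :
    tangentCoord p (γ t) (S.covDerivAlong γ X t) =
      deriv (fun u ↦ tangentCoord p (γ u) (X u)) t + ∑ i, ∑ j,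
        (tangentCoord p (γ t) (X t) i * deriv (fun u ↦ extChartAt (𝓡 2) p (γ u)) t j) •
          S.christoffel p i j (γ t) := by
  rw [← tangentCoord_velocity h hγ]
  rw [← S.tangentCoord_D h]
  set ξ : ℝ → Plane := fun u ↦ tangentCoord p (γ u) (X u) with hξ
  set E : Fin 2 → ∀ q : M, TangentSpace (𝓡 2) q :=
    fun i ↦ constSection p (EuclideanSpace.single i 1) with hE
  have hEd : ∀ i, MDifferentiableAt (𝓡 2) ((𝓡 2).prod 𝓘(ℝ, Plane))
      (fun q ↦ TotalSpace.mk' Plane q (E i q)) (γ t) := fun i ↦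
    mdifferentiableAt_constSection h _
  have hq := mem_chart_source Plane (γ t)
  have hη : ∀ i, DifferentiableAt ℝ (fun u ↦ tangentCoord (γ t) (γ u) (E i (γ u))) t := fun i ↦
    (((mdifferentiableAt_section_iff_tangentCoord hq).1 (hEd i)).comp t hγ).differentiableAt
  have hξi : ∀ i : Fin 2, HasDerivAt (fun u ↦ ξ u i) (deriv ξ t i) t := fun i ↦
    ((EuclideanSpace.proj (𝕜 := ℝ) i : Plane →L[ℝ] ℝ).hasFDerivAt.comp_hasDerivAt t
        hX.hasDerivAt)
  have hXsum : ∀ u, γ u ∈ (chartAt Plane p).source → X u = ξ u 0 • E 0 (γ u) + ξ u 1 • E 1 (γ u) := by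
    intro u hu
    conv_lhs => rw [← constSection_tangentCoord hu (X u), plane_eq_sum (tangentCoord p (γ u) (X u)),
      constSection_add, constSection_smul, constSection_smul]
    rfl
  -- The derivative along the curve is defined in the trivialization at the moving point `γ t`.
  -- Expanding `X` in the frame `E` belonging to the fixed point `p` and using the product rule
  -- separates the derivatives of the coefficients from those of the frame.
  have hd : deriv (fun u ↦ (trivializationAt Plane (fun q : M ↦ TangentSpace (𝓡 2) q) (γ t)
      ⟨γ u, X u⟩).2) t =
      (deriv ξ t 0 • tangentCoord (γ t) (γ t) (E 0 (γ t)) +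
        deriv ξ t 1 • tangentCoord (γ t) (γ t) (E 1 (γ t))) +
      (ξ t 0 • deriv (fun u ↦ tangentCoord (γ t) (γ u) (E 0 (γ u))) t +
        ξ t 1 • deriv (fun u ↦ tangentCoord (γ t) (γ u) (E 1 (γ u))) t) := by
    have h1 : (fun u ↦ (trivializationAt Plane (fun q : M ↦ TangentSpace (𝓡 2) q) (γ t)
        ⟨γ u, X u⟩).2) =ᶠ[𝓝 t] fun u ↦ ξ u 0 • tangentCoord (γ t) (γ u) (E 0 (γ u)) +
          ξ u 1 • tangentCoord (γ t) (γ u) (E 1 (γ u)) := by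
      filter_upwards [hγ.continuousAt.eventually ((chartAt Plane (γ t)).open_source.mem_nhds hq),
        hγ.continuousAt.eventually ((chartAt Plane p).open_source.mem_nhds h)] with u hu hu'
      rw [trivializationAt_snd hu]
      conv_lhs => rw [hXsum u hu', map_add, map_smul, map_smul]
    rw [h1.deriv_eq]
    have := ((hξi 0).smul (hη 0).hasDerivAt).add ((hξi 1).smul (hη 1).hasDerivAt)
    refine this.deriv.trans ?_
    module
  have hc : S.covDerivAlong γ X t = constSection p (deriv ξ t) (γ t) +
      S.D (constSection p (ξ t)) (γ t) (velocity γ t) := by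
    rw [covDerivAlong, hd]
    -- The zero vector is paired with the part of the coordinate derivative that comes from `deriv
    -- ξ`; each frame field is paired with its own coordinate derivative, as `covDerivAux_section`
    -- requires.
    have h0 : X t = 0 + (ξ t 0 • E 0 (γ t) + ξ t 1 • E 1 (γ t)) := by
      rw [zero_add]; exact hXsum t h
    rw [h0, covDerivAux_add, covDerivAux_zero_left, covDerivAux_add, covDerivAux_smul,
      covDerivAux_smul, S.covDerivAux_section hγ (hEd 0), S.covDerivAux_section hγ (hEd 1)]
    congr 1
    · rw [← map_smul, ← map_smul, ← map_add, constSection_tangentCoord hq]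
      conv_rhs => rw [plane_eq_sum (deriv ξ t), constSection_add, constSection_smul,
        constSection_smul]
      rfl
    · conv_rhs => rw [plane_eq_sum (ξ t), S.D_constSection_add h, S.D_constSection_smul h,
        S.D_constSection_smul h]
      rfl
  rw [hc, map_add, tangentCoord_constSection h]

end EquiAffineStructure

end Coordinates

/-! ### Calculus of smooth germs at `0`. -/

section SmoothGerms

variable {E F : Type*} [NormedAddCommGroup E] [NormedSpace ℝ E] [NormedAddCommGroup F]
  [NormedSpace ℝ F]

/-- The function `f` of a real variable is smooth near `0`. -/
def SmoothGerm (f : ℝ → E) : Prop := ∀ᶠ t in 𝓝 (0 : ℝ), ContDiffAt ℝ ∞ f t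

namespace SmoothGerm

variable {f g : ℝ → E}

theorem contDiffAt (hf : SmoothGerm f) : ContDiffAt ℝ ∞ f 0 := hf.self_of_nhds

theorem continuousAt (hf : SmoothGerm f) : ContinuousAt f 0 := hf.contDiffAt.continuousAt

theorem differentiableAt (hf : SmoothGerm f) : DifferentiableAt ℝ f 0 :=
  hf.contDiffAt.differentiableAt (by simp)

theorem eventually_differentiableAt (hf : SmoothGerm f) :
    ∀ᶠ t in 𝓝 (0 : ℝ), DifferentiableAt ℝ f t :=
  hf.mono fun _ h ↦ h.differentiableAt (by simp)

theorem _root_.ContDiff.smoothGerm (hf : ContDiff ℝ ∞ f) : SmoothGerm f :=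
  Eventually.of_forall fun _ ↦ hf.contDiffAt

theorem const (c : E) : SmoothGerm fun _ : ℝ ↦ c := contDiff_const.smoothGerm

theorem id : SmoothGerm fun t : ℝ ↦ t := contDiff_id.smoothGerm

theorem add (hf : SmoothGerm f) (hg : SmoothGerm g) : SmoothGerm fun t ↦ f t + g t :=
  hf.mp (hg.mono fun _ h h' ↦ h'.add h)

theorem sub (hf : SmoothGerm f) (hg : SmoothGerm g) : SmoothGerm fun t ↦ f t - g t :=
  hf.mp (hg.mono fun _ h h' ↦ h'.sub h)

theorem smul {a : ℝ → ℝ} (ha : SmoothGerm a) (hf : SmoothGerm f) : SmoothGerm fun t ↦ a t • f t :=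
  ha.mp (hf.mono fun _ h h' ↦ h'.smul h)

theorem mul {a b : ℝ → ℝ} (ha : SmoothGerm a) (hb : SmoothGerm b) : SmoothGerm fun t ↦ a t * b t :=
  ha.mp (hb.mono fun _ h h' ↦ h'.mul h)

theorem pow {a : ℝ → ℝ} (ha : SmoothGerm a) (n : ℕ) : SmoothGerm fun t ↦ a t ^ n :=
  ha.mono fun _ h ↦ h.pow n

theorem div {a b : ℝ → ℝ} (ha : SmoothGerm a) (hb : SmoothGerm b) (h0 : b 0 ≠ 0) :
    SmoothGerm fun t ↦ a t / b t := by
  filter_upwards [ha, hb, hb.continuousAt.eventually_ne h0] with t h1 h2 h3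
  exact h1.div h2 h3

theorem sum {ι : Type*} (s : Finset ι) {f : ι → ℝ → E} (hf : ∀ i ∈ s, SmoothGerm (f i)) :
    SmoothGerm fun t ↦ ∑ i ∈ s, f i t := by
  have : ∀ᶠ t in 𝓝 (0 : ℝ), ∀ i ∈ s, ContDiffAt ℝ ∞ (f i) t :=
    (Filter.eventually_all_finset s).2 hf
  filter_upwards [this] with t ht
  exact ContDiffAt.sum ht

theorem deriv (hf : SmoothGerm f) : SmoothGerm (deriv f) :=
  hf.mono fun _ h ↦ by
    have : _root_.deriv f = fun t ↦ fderiv ℝ f t 1 := by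
      ext1 t; exact fderiv_apply_one_eq_deriv.symm
    rw [this]
    exact (h.fderiv_right (m := ∞) (by simp)).clm_apply contDiffAt_const

theorem clm (L : E →L[ℝ] F) (hf : SmoothGerm f) : SmoothGerm fun t ↦ L (f t) :=
  hf.mono fun _ h ↦ L.contDiff.contDiffAt.comp _ h

theorem congr (hf : SmoothGerm f) (h : f =ᶠ[𝓝 0] g) : SmoothGerm g := by
  filter_upwards [hf, h.eventually_nhds] with t h1 h2
  exact h1.congr_of_eventuallyEq (h2.mono fun _ h ↦ h.symm)

theorem comp_contDiffOn {U : Set E} (hU : IsOpen U) {G : E → F} (hG : ContDiffOn ℝ ∞ G U)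
    (hf : SmoothGerm f) (h0 : f 0 ∈ U) : SmoothGerm fun t ↦ G (f t) := by
  filter_upwards [hf, hf.continuousAt.eventually (hU.mem_nhds h0)] with t h1 h2
  exact (hG.contDiffAt (hU.mem_nhds h2)).comp t h1

theorem comp {a : ℝ → ℝ} (hf : SmoothGerm f) (ha : SmoothGerm a) (h0 : a 0 = 0) :
    SmoothGerm fun t ↦ f (a t) := by
  have : Tendsto a (𝓝 0) (𝓝 0) := by simpa [h0] using ha.continuousAt.tendsto
  filter_upwards [ha, this.eventually hf] with t h1 h2
  exact h2.comp t h1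

end SmoothGerm

end SmoothGerms

/-! ### The planar model of an equi-affine structure. -/

/-- An equi-affine structure on an open subset of the coordinate plane: the coordinates
`Γ i j` of `D_{e_j} e_i` and the coefficient `dens` of the area form. -/
structure PlanarEquiAffine where
  U : Set Plane
  isOpen_U : IsOpen U
  Γ : Fin 2 → Fin 2 → Plane → Plane
  dens : Plane → ℝ
  smooth_Γ : ∀ i j, ContDiffOn ℝ ∞ (Γ i j) U
  smooth_dens : ContDiffOn ℝ ∞ dens U
  dens_ne_zero : ∀ y ∈ U, dens y ≠ 0
  parallel : ∀ y ∈ U, ∀ v : Plane,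
    fderiv ℝ dens y v = dens y * ∑ j, v j * (Γ 0 j y 0 + Γ 1 j y 1)

namespace PlanarEquiAffine

variable (L : PlanarEquiAffine)

/-- The covariant derivative of the vector field `ξ` along the curve `x`. -/
noncomputable def nabla (x ξ : ℝ → Plane) (t : ℝ) : Plane :=
  deriv ξ t + ∑ i, ∑ j, (ξ t i * deriv x t j) • L.Γ i j (x t)

/-- The area spanned by two vector fields along the curve `x`. -/
noncomputable def area (x ξ η : ℝ → Plane) (t : ℝ) : ℝ :=
  L.dens (x t) * (ξ t 0 * η t 1 - ξ t 1 * η t 0)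

/-- The iterated covariant derivatives of a curve, starting with the velocity. -/
noncomputable def curveDeriv (x : ℝ → Plane) : ℕ → ℝ → Plane
  | 0 => deriv x
  | k + 1 => L.nabla x (curveDeriv x k)

variable {L}

theorem _root_.SmoothGerm.coord {ξ : ℝ → Plane} (hξ : SmoothGerm ξ) (i : Fin 2) :
    SmoothGerm fun t ↦ ξ t i :=
  hξ.clm (EuclideanSpace.proj (𝕜 := ℝ) i : Plane →L[ℝ] ℝ)

theorem smoothGerm_nabla {x ξ : ℝ → Plane} (hx : SmoothGerm x) (h0 : x 0 ∈ L.U)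
    (hξ : SmoothGerm ξ) : SmoothGerm (L.nabla x ξ) :=
  hξ.deriv.add <| SmoothGerm.sum _ fun i _ ↦ SmoothGerm.sum _ fun j _ ↦
    ((hξ.coord i).mul (hx.deriv.coord j)).smul (hx.comp_contDiffOn L.isOpen_U (L.smooth_Γ i j) h0)

theorem smoothGerm_area {x ξ η : ℝ → Plane} (hx : SmoothGerm x) (h0 : x 0 ∈ L.U)
    (hξ : SmoothGerm ξ) (hη : SmoothGerm η) : SmoothGerm (L.area x ξ η) :=
  (hx.comp_contDiffOn L.isOpen_U L.smooth_dens h0).mul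
    (((hξ.coord 0).mul (hη.coord 1)).sub ((hξ.coord 1).mul (hη.coord 0)))

theorem smoothGerm_curveDeriv {x : ℝ → Plane} (hx : SmoothGerm x) (h0 : x 0 ∈ L.U) (k : ℕ) :
    SmoothGerm (L.curveDeriv x k) := by
  induction k with
  | zero => exact hx.deriv
  | succ k ih => exact smoothGerm_nabla hx h0 ih

theorem nabla_congr {x ξ η : ℝ → Plane} (h : ξ =ᶠ[𝓝 0] η) :
    L.nabla x ξ =ᶠ[𝓝 0] L.nabla x η := by
  filter_upwards [h, h.eventually_nhds] with t h1 h2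
  have h3 : ξ =ᶠ[𝓝 t] η := h2
  rw [nabla, nabla, h1, h3.deriv_eq]

end PlanarEquiAffine

/-! ### Passage from the surface to the planar model. -/

namespace EquiAffineStructure

variable {M : Type*} [TopologicalSpace M] [ChartedSpace Plane M]
  [IsManifold (𝓡 2) ∞ M] (S : EquiAffineStructure M)

theorem contMDiffAt_areaCoeff {p q : M} (h : q ∈ (chartAt Plane p).source) :
    ContMDiffAt (𝓡 2) 𝓘(ℝ, ℝ) ∞ (S.areaCoeff p) q := by
  have h1 := (S.smooth_Ω.contMDiffAt (x := q)).clm_bundle_apply₂ (F₃ := ℝ)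
    (E₃ := Bundle.Trivial M ℝ) (b := fun q ↦ q)
    (contMDiffAt_constSection h (EuclideanSpace.single 0 1))
    (contMDiffAt_constSection h (EuclideanSpace.single 1 1))
  rw [contMDiffAt_section] at h1
  exact h1

/-- Smoothness of `D` is used on globally smooth fields, while frame fields are smooth only on a
chart domain. A bump function at `p` makes them global; locality of `D` then gives smoothness where
the bump equals one, hence only near `p`. -/
theorem eventually_contMDiffAt_christoffel [T2Space M] (p : M) :
    ∀ᶠ q in 𝓝 p, ∀ i j, ContMDiffAt (𝓡 2) 𝓘(ℝ, Plane) ∞ (S.christoffel p i j) q := by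
  obtain ⟨f⟩ : Nonempty (SmoothBumpFunction (𝓡 2) p) := inferInstance
  have hc := (chartAt Plane p).open_source
  filter_upwards [f.eventuallyEq_one.eventually_nhds, hc.mem_nhds (mem_chart_source Plane p)]
    with q hf hq i j
  have hσ : ContMDiff (𝓡 2) ((𝓡 2).prod 𝓘(ℝ, Plane)) ∞ (fun q ↦ TotalSpace.mk' Plane q
      (((f : M → ℝ) • constSection p (EuclideanSpace.single i 1)) q)) := by
    refine ContMDiffOn.smul_section_of_tsupport f.contMDiff.contMDiffOn hc
      f.tsupport_subset_chartAt_source ?_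
    exact fun q hq ↦ (contMDiffAt_constSection hq _).contMDiffWithinAt
  have hD := (S.smooth_D.contMDiff.contMDiff (σ := (f : M → ℝ) •
    constSection p (EuclideanSpace.single i 1)) (by simpa using hσ.contMDiffOn)).contMDiffAt
      (x := q) univ_mem
  have h1 := hD.clm_bundle_apply (b := fun q ↦ q)
    (contMDiffAt_constSection hq (EuclideanSpace.single j 1))
  rw [contMDiffAt_section_iff_tangentCoord hq] at h1
  refine h1.congr_of_eventuallyEq ?_
  filter_upwards [hf.eventually_nhds, hc.mem_nhds hq] with q' hf' hq'
  rw [christoffel]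
  congr 2
  refine S.D.isCovariantDerivativeOnUniv.congr_of_eventuallyEq
    (mdifferentiableAt_constSection hq' _)
    (hσ.contMDiffAt.mdifferentiableAt (by simp)) univ_mem ?_
  filter_upwards [hf'] with r hr
  simp [hr]

/-- `DΩ = 0` evaluated on the frame: the logarithmic derivative of the density is the trace of the
connection matrix. -/
theorem mvfderiv_areaCoeff {p q : M} (h : q ∈ (chartAt Plane p).source) (v : Plane) :
    mvfderiv (𝓡 2) (S.areaCoeff p) q (constSection p v q) =
      S.areaCoeff p q * ∑ j, v j * (S.christoffel p 0 j q 0 + S.christoffel p 1 j q 1) := by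
  have := S.parallel q _ _ (mdifferentiableAt_constSection h (EuclideanSpace.single 0 1))
    (mdifferentiableAt_constSection h (EuclideanSpace.single 1 1)) (constSection p v q)
  refine this.trans ?_
  rw [S.Ω_eq h, S.Ω_eq h, S.tangentCoord_D h, S.tangentCoord_D h]
  simp only [tangentCoord_constSection h, Fin.sum_univ_two]
  simp
  ring

/-- In the preferred chart at a point, an equi-affine structure is given by a planar one. -/
theorem exists_planarEquiAffine [T2Space M] (p : M) :
    ∃ L : PlanarEquiAffine, extChartAt (𝓡 2) p p ∈ L.U ∧ L.U ⊆ (extChartAt (𝓡 2) p).target ∧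
      ∀ γ : ℝ → M, (∀ᶠ t in 𝓝 (0 : ℝ), ContMDiffAt 𝓘(ℝ, ℝ) (𝓡 2) ∞ γ t) → γ 0 = p →
        ∀ i j, S.bracket γ i j =ᶠ[𝓝 0] L.area (fun t ↦ extChartAt (𝓡 2) p (γ t))
          (L.curveDeriv (fun t ↦ extChartAt (𝓡 2) p (γ t)) i)
          (L.curveDeriv (fun t ↦ extChartAt (𝓡 2) p (γ t)) j) := by
  set φ := extChartAt (𝓡 2) p with hφ
  have hsrc : ∀ y ∈ φ.target, φ.symm y ∈ (chartAt Plane p).source := fun y hy ↦ by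
    rw [← extChartAt_source (𝓡 2)]; exact φ.map_target hy
  have hsm : ∀ y ∈ φ.target, ContMDiffAt 𝓘(ℝ, Plane) (𝓡 2) ∞ φ.symm y := fun y hy ↦
    (contMDiffOn_extChartAt_symm p).contMDiffAt ((isOpen_extChartAt_target p).mem_nhds hy)
  obtain ⟨W, hW, hWo, hpW⟩ := eventually_nhds_iff.1 (S.eventually_contMDiffAt_christoffel p)
  -- The domain is cut down to `W`, where the Christoffel symbols are known to be smooth.
  let L : PlanarEquiAffine :=
    { U := φ.target ∩ φ.symm ⁻¹' W
      isOpen_U := (continuousOn_extChartAt_symm p).isOpen_inter_preimage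
        (isOpen_extChartAt_target p) hWo
      Γ := fun i j y ↦ S.christoffel p i j (φ.symm y)
      dens := fun y ↦ S.areaCoeff p (φ.symm y)
      smooth_Γ := fun i j y hy ↦
        (((hW _ hy.2 i j).comp y (hsm y hy.1)).contDiffAt).contDiffWithinAt
      smooth_dens := fun y hy ↦ (((S.contMDiffAt_areaCoeff (hsrc y hy.1)).comp y
        (hsm y hy.1)).contDiffAt).contDiffWithinAt
      dens_ne_zero := fun y hy ↦ S.areaCoeff_ne_zero (hsrc y hy.1)
      parallel := fun y hy v ↦ by
        have h1 := S.mvfderiv_areaCoeff (hsrc y hy.1) v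
        rw [← h1]
        have h2 := mvfderiv_comp_apply (I := 𝓡 2) (I' := 𝓘(ℝ, Plane)) y
          ((S.contMDiffAt_areaCoeff (hsrc y hy.1)).mdifferentiableAt (by simp))
          ((hsm y hy.1).mdifferentiableAt (by simp)) v
        have h3 := TangentBundle.symmL_trivializationAt (I := 𝓡 2) (hsrc y hy.1)
        -- A frame field with constant coordinates is the push-forward of a constant vector by the
        -- inverse chart, so the chain rule turns the intrinsic identity into one for `fderiv`.
        have h4 : constSection p v (φ.symm y) = mfderiv 𝓘(ℝ, Plane) (𝓡 2) φ.symm y v := by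
          rw [constSection, h3, ← hφ, φ.right_inv hy.1, ModelWithCorners.range_eq_univ,
            mfderivWithin_univ]
          rfl
        rw [h4]
        refine Eq.trans ?_ h2
        rw [mvfderiv, mfderiv_eq_fderiv]
        rfl }
  refine ⟨L, ⟨mem_extChartAt_target p, ?_⟩, Set.inter_subset_left, fun γ hγ h0 ↦ ?_⟩
  · change φ.symm (φ p) ∈ W
    rw [hφ, extChartAt_to_inv]
    exact hpW
  set x : ℝ → Plane := fun t ↦ φ (γ t) with hx
  have hγc : ContinuousAt γ 0 := hγ.self_of_nhds.continuousAt
  have hγs : ∀ᶠ t in 𝓝 (0 : ℝ), γ t ∈ (chartAt Plane p).source :=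
    hγc.eventually ((chartAt Plane p).open_source.mem_nhds (by rw [h0]; exact mem_chart_source _ _))
  have hxs : SmoothGerm x := by
    filter_upwards [hγ, hγs] with t h1 h2
    exact (((contMDiffAt_extChartAt' h2).comp t h1)).contDiffAt
  have hx0 : x 0 ∈ L.U := by
    refine ⟨?_, ?_⟩
    · rw [hx]; simp only [h0]; exact mem_extChartAt_target p
    · change φ.symm (φ (γ 0)) ∈ W
      rw [h0, hφ, extChartAt_to_inv]
      exact hpW
  have key : ∀ k, (fun t ↦ tangentCoord p (γ t) (S.curveDeriv γ k t)) =ᶠ[𝓝 0]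
      L.curveDeriv x k := by
    intro k
    induction k with
    | zero =>
      filter_upwards [hγ, hγs] with t h1 h2
      exact tangentCoord_velocity h2 (h1.mdifferentiableAt (by simp))
    | succ k ih =>
      have hd := (PlanarEquiAffine.smoothGerm_curveDeriv hxs hx0 k).eventually_differentiableAt
      filter_upwards [hγ, hγs, ih, ih.eventually_nhds, hd] with t h1 h2 h3 h4 h5
      have h4' : (fun t ↦ tangentCoord p (γ t) (S.curveDeriv γ k t)) =ᶠ[𝓝 t]
        L.curveDeriv x k := h4
      refine (S.tangentCoord_covDerivAlong (X := S.curveDeriv γ k) h2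
        (h1.mdifferentiableAt (by simp)) (h4'.differentiableAt_iff.2 h5)).trans ?_
      rw [h4'.deriv_eq, h3]
      change _ = L.nabla x _ t
      rw [PlanarEquiAffine.nabla]
      congr 1
      refine Finset.sum_congr rfl fun i _ ↦ Finset.sum_congr rfl fun j _ ↦ ?_
      congr 1
      change _ = S.christoffel p i j (φ.symm (φ (γ t)))
      rw [φ.left_inv (by rw [hφ, extChartAt_source]; exact h2)]
  intro i j
  filter_upwards [hγs, key i, key j] with t h1 h2 h3
  rw [bracket, S.Ω_eq h1, h2, h3, PlanarEquiAffine.area]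
  congr 1
  change _ = S.areaCoeff p (φ.symm (φ (γ t)))
  rw [φ.left_inv (by rw [hφ, extChartAt_source]; exact h1)]

end EquiAffineStructure

/-! ### Weighted averages and Hadamard's lemma. -/

section WeightedAverage

variable {E : Type*} [NormedAddCommGroup E] [NormedSpace ℝ E]

/-- The weighted average `∫₀¹ r ^ a v(r t) dr`. -/
noncomputable def weightedAverage (a : ℝ) (v : ℝ → E) (t : ℝ) : E :=
  ∫ r in (0 : ℝ)..1, r ^ a • v (r * t)

theorem weightedAverage_zero_right [CompleteSpace E] {a : ℝ} (ha : 0 ≤ a) (v : ℝ → E) :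
    weightedAverage a v 0 = (a + 1)⁻¹ • v 0 := by
  simp only [weightedAverage, mul_zero]
  rw [intervalIntegral.integral_smul_const, integral_rpow (Or.inl (by linarith)),
    Real.one_rpow, Real.zero_rpow (by linarith)]
  simp

/-- Differentiation under the integral sign: the factor `r` from the chain rule raises the exponent
of the weight by one, which is why smoothness is later proved by induction over all exponents at
once. -/
theorem hasDerivAt_weightedAverage {a : ℝ} (ha : 0 ≤ a) {v : ℝ → E} (hv : ContDiff ℝ ∞ v) (t : ℝ) :
    HasDerivAt (weightedAverage a v) (weightedAverage (a + 1) (deriv v) t) t := by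
  have hv1 : Continuous (deriv v) := hv.continuous_deriv (by simp)
  have hdv : Differentiable ℝ v := hv.differentiable (by simp)
  have hc : Continuous fun r : ℝ ↦ r ^ a := Real.continuous_rpow_const ha
  have hc1 : Continuous fun r : ℝ ↦ r ^ (a + 1) := Real.continuous_rpow_const (by linarith)
  obtain ⟨C, hC⟩ := (isCompact_closedBall (0 : ℝ) (|t| + 1)).exists_bound_of_continuousOn
    hv1.continuousOn
  have hF : ∀ s, Continuous fun r : ℝ ↦ r ^ a • v (r * s) := fun s ↦
    hc.smul (hv.continuous.comp (continuous_mul_const s))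
  have hF1 : ∀ s, Continuous fun r : ℝ ↦ r ^ (a + 1) • deriv v (r * s) := fun s ↦
    hc1.smul (hv1.comp (continuous_mul_const s))
  refine (intervalIntegral.hasDerivAt_integral_of_dominated_loc_of_deriv_le
    (F := fun s r ↦ r ^ a • v (r * s)) (F' := fun s r ↦ r ^ (a + 1) • deriv v (r * s))
    (bound := fun _ ↦ C) (Metric.ball_mem_nhds t one_pos)
    (Eventually.of_forall fun s ↦ (hF s).aestronglyMeasurable) ((hF t).intervalIntegrable _ _)
    (hF1 t).aestronglyMeasurable (Eventually.of_forall fun r hr s hs ↦ ?_)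
    intervalIntegrable_const (Eventually.of_forall fun r hr s hs ↦ ?_)).2
  · rw [Set.uIoc_of_le zero_le_one] at hr
    rw [norm_smul, Real.norm_of_nonneg (Real.rpow_nonneg hr.1.le _)]
    have h1 : r ^ (a + 1) ≤ 1 := Real.rpow_le_one hr.1.le hr.2 (by linarith)
    have h2 : ‖deriv v (r * s)‖ ≤ C := by
      refine hC _ ?_
      rw [mem_closedBall_zero_iff, Real.norm_eq_abs, abs_mul, abs_of_pos hr.1]
      rw [Metric.mem_ball, Real.dist_eq] at hs
      have : |s| ≤ |t| + 1 := by
        have := abs_sub_abs_le_abs_sub s t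
        linarith
      nlinarith [abs_nonneg s, hr.1, hr.2]
    calc r ^ (a + 1) * ‖deriv v (r * s)‖ ≤ 1 * ‖deriv v (r * s)‖ := by gcongr
      _ ≤ C := by rw [one_mul]; exact h2
  · rw [Set.uIoc_of_le zero_le_one] at hr
    have h1 : HasDerivAt (fun s ↦ v (r * s)) (r • deriv v (r * s)) s := by
      have := (hdv (r * s)).hasDerivAt.scomp s ((hasDerivAt_id s).const_mul r)
      simpa [Function.comp_def] using this
    have h2 := h1.const_smul (r ^ a)
    rwa [smul_smul, ← Real.rpow_add_one hr.1.ne'] at h2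

theorem contDiff_weightedAverage {a : ℝ} (ha : 0 ≤ a) {v : ℝ → E} (hv : ContDiff ℝ ∞ v) :
    ContDiff ℝ ∞ (weightedAverage a v) := by
  rw [contDiff_infty]
  intro n
  induction n generalizing a v with
  | zero =>
    exact contDiff_zero.2 (continuous_iff_continuousAt.2 fun t ↦
      (hasDerivAt_weightedAverage ha hv t).continuousAt)
  | succ n ih =>
    have h : deriv (weightedAverage a v) = weightedAverage (a + 1) (deriv v) :=
      funext fun t ↦ (hasDerivAt_weightedAverage ha hv t).deriv
    rw [Nat.cast_add, Nat.cast_one, contDiff_succ_iff_deriv]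
    refine ⟨fun t ↦ (hasDerivAt_weightedAverage ha hv t).differentiableAt, by simp, ?_⟩
    rw [h]
    exact ih (by linarith) (contDiff_infty_iff_deriv.1 hv).2

theorem integral_eq_smul_integral (g : ℝ → E) (t : ℝ) :
    ∫ r in (0 : ℝ)..t, g r = t • ∫ r in (0 : ℝ)..1, g (r * t) := by
  rw [intervalIntegral.smul_integral_comp_mul_right]
  simp

theorem integral_smul_eq_weightedAverage (v : ℝ → E) (t : ℝ) :
    ∫ r in (0 : ℝ)..t, r • v r = t ^ 2 • weightedAverage 1 v t := by
  rw [integral_eq_smul_integral, pow_two, mul_smul, weightedAverage]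
  congr 1
  rw [← intervalIntegral.integral_smul]
  refine intervalIntegral.integral_congr fun r _ ↦ ?_
  simp only [Real.rpow_one, smul_smul]
  ring_nf

/-- Hadamard's lemma in one variable. -/
theorem sub_eq_smul_weightedAverage [CompleteSpace E] {v : ℝ → E} (hv : ContDiff ℝ ∞ v) (t : ℝ) :
    v t - v 0 = t • weightedAverage 0 (deriv v) t := by
  rw [← intervalIntegral.integral_deriv_eq_sub (fun s _ ↦ (hv.differentiable (by simp)) s)
    ((hv.continuous_deriv (by simp)).intervalIntegrable _ _), integral_eq_smul_integral]
  simp [weightedAverage]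

namespace SmoothGerm

/-- A smooth germ is the germ of a globally smooth function. -/
theorem exists_contDiff {f : ℝ → E} (hf : SmoothGerm f) :
    ∃ g : ℝ → E, ContDiff ℝ ∞ g ∧ g =ᶠ[𝓝 0] f := by
  obtain ⟨ε, hε, h⟩ := Metric.eventually_nhds_iff.1 hf
  -- The support lies strictly inside the ball of radius `ε` on which `f` is smooth.
  let χ : ContDiffBump (0 : ℝ) := ⟨ε / 4, ε / 2, by positivity, by linarith⟩
  refine ⟨fun t ↦ χ t • f t, contDiff_iff_contDiffAt.2 fun t ↦ ?_, ?_⟩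
  · by_cases ht : dist t 0 < ε
    · exact χ.contDiff.contDiffAt.smul (h ht)
    · refine (contDiffAt_const (c := (0 : E))).congr_of_eventuallyEq ?_
      have : t ∉ tsupport χ := by
        rw [χ.tsupport_eq, Metric.mem_closedBall]
        change ¬ dist t 0 ≤ ε / 2
        linarith
      filter_upwards [(isClosed_tsupport χ).isOpen_compl.mem_nhds this] with s hs
      rw [image_eq_zero_of_notMem_tsupport hs, zero_smul]
  · filter_upwards [χ.eventuallyEq_one] with t ht
    simp [ht]

/-- Hadamard's lemma for a global representative of the germ: a smooth germ vanishing at `0` is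
divisible by `t`. -/
theorem exists_eq_smul [CompleteSpace E] {f : ℝ → E} (hf : SmoothGerm f) (h0 : f 0 = 0) :
    ∃ g : ℝ → E, SmoothGerm g ∧ (f =ᶠ[𝓝 0] fun t ↦ t • g t) ∧ g 0 = _root_.deriv f 0 := by
  obtain ⟨F, hF, hFf⟩ := hf.exists_contDiff
  refine ⟨weightedAverage 0 (_root_.deriv F),
    (contDiff_weightedAverage le_rfl (contDiff_infty_iff_deriv.1 hF).2).smoothGerm, ?_, ?_⟩
  · filter_upwards [hFf] with t ht
    rw [← ht, ← sub_eq_smul_weightedAverage hF, hFf.eq_of_nhds, h0, sub_zero]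
  · rw [weightedAverage_zero_right le_rfl, hFf.deriv_eq]
    simp

end SmoothGerm

end WeightedAverage

/-! ### The theorems of Borel and Whitney. -/

/-- **Borel's lemma**: every sequence is the sequence of derivatives at `0` of a smooth function. -/
theorem exists_contDiff_iteratedDeriv_eq (c : ℕ → ℝ) :
    ∃ g : ℝ → ℝ, ContDiff ℝ ∞ g ∧ ∀ n, iteratedDeriv n g 0 = c n := by
  let χ : ContDiffBump (0 : ℝ) := ⟨1, 2, one_pos, one_lt_two⟩
  have hχ : ContDiff ℝ ∞ χ := χ.contDiff
  let ψ : ℕ → ℝ → ℝ := fun n x ↦ x ^ n * χ x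
  have hψ : ∀ n, ContDiff ℝ ∞ (ψ n) := fun n ↦ (contDiff_id.pow n).mul hχ
  have hψc : ∀ n, HasCompactSupport (ψ n) := fun n ↦ χ.hasCompactSupport.mul_left
  have hB : ∀ n k, ∃ C, ∀ x, ‖iteratedDeriv k (ψ n) x‖ ≤ C := fun n k ↦ by
    obtain ⟨C, hC⟩ := ((hψc n).iteratedFDeriv k).exists_bound_of_continuous
      ((hψ n).continuous_iteratedFDeriv (by exact_mod_cast le_top))
    exact ⟨C, fun x ↦ by rw [← norm_iteratedFDeriv_eq_norm_iteratedDeriv]; exact hC x⟩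
  choose B hB using hB
  have hB0 : ∀ n k, 0 ≤ B n k := fun n k ↦ (norm_nonneg _).trans (hB n k 0)
  -- Compressing the `n`-th cut-off monomial by `l n` costs `l n ^ k` in the `k`-th derivative,
  -- while its coefficient contains `l n ^ (-n)`. For `k < n` at least one factor `1 / l n` remains,
  -- and `l n` is large enough to make the term at most `2 ^ (-n)`.
  let l : ℕ → ℝ := fun n ↦ 2 ^ n * (1 + |c n|) * (1 + ∑ k ∈ Finset.range n, B n k)
  have hS : ∀ n, 0 ≤ ∑ k ∈ Finset.range n, B n k := fun n ↦ Finset.sum_nonneg fun k _ ↦ hB0 n k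
  have hl1 : ∀ n, 1 ≤ l n := fun n ↦ by
    have h1 : (1 : ℝ) ≤ 2 ^ n := one_le_pow₀ one_le_two
    have h2 : 1 ≤ 1 + |c n| := by linarith [abs_nonneg (c n)]
    have h3 := hS n
    exact one_le_mul_of_one_le_of_one_le (one_le_mul_of_one_le_of_one_le h1 h2) (by linarith)
  have hl0 : ∀ n, 0 < l n := fun n ↦ one_pos.trans_le (hl1 n)
  let a : ℕ → ℝ := fun n ↦ c n / n.factorial / l n ^ n
  let φ : ℕ → ℝ → ℝ := fun n x ↦ a n * ψ n (l n * x)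
  have hφ : ∀ n, ContDiff ℝ ∞ (φ n) := fun n ↦
    contDiff_const.mul ((hψ n).comp (contDiff_const.mul contDiff_id))
  have hφd : ∀ n k x, iteratedDeriv k (φ n) x =
      a n * (l n ^ k * iteratedDeriv k (ψ n) (l n * x)) := fun n k x ↦ by
    rw [iteratedDeriv_const_mul_field,
      iteratedDeriv_comp_const_mul ((hψ n).of_le (by exact_mod_cast le_top))]
  -- For fixed `k` only the tail `n > k` matters for summability; the finitely many other terms get
  -- their crude bound.
  let v : ℕ → ℕ → ℝ := fun k n ↦ if k < n then (1 / 2) ^ n else |a n| * (l n ^ k * B n k)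
  have hv : ∀ k : ℕ, (k : ℕ∞) ≤ ⊤ → Summable (v k) := fun k _ ↦ by
    refine (summable_geometric_two).congr_cofinite ?_
    rw [Nat.cofinite_eq_atTop]
    filter_upwards [eventually_gt_atTop k] with n hn
    simp [v, hn]
  have hvb : ∀ (k n : ℕ) (x : ℝ), (k : ℕ∞) ≤ ⊤ → ‖iteratedFDeriv ℝ k (φ n) x‖ ≤ v k n := by
    intro k n x _
    rw [norm_iteratedFDeriv_eq_norm_iteratedDeriv, hφd, norm_mul, norm_mul, norm_pow,
      Real.norm_of_nonneg (hl0 n).le, Real.norm_eq_abs (a n)]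
    have hle : |a n| * (l n ^ k * ‖iteratedDeriv k (ψ n) (l n * x)‖) ≤
        |a n| * (l n ^ k * B n k) := by
      have := hB n k (l n * x)
      have := (hl0 n).le
      gcongr
    refine hle.trans ?_
    by_cases hk : k < n
    · simp only [v, hk, if_true]
      have h1 : |a n| ≤ |c n| / l n ^ n := by
        simp only [a]
        rw [abs_div, abs_div, abs_of_pos (pow_pos (hl0 n) n), Nat.abs_cast]
        have : (1 : ℝ) ≤ n.factorial := by exact_mod_cast Nat.one_le_iff_ne_zero.2 n.factorial_ne_zero
        have := pow_pos (hl0 n) n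
        gcongr
        exact div_le_self (abs_nonneg _) ‹_›
      have h2 : l n ^ (k + 1) ≤ l n ^ n := pow_le_pow_right₀ (hl1 n) hk
      have h3 : B n k ≤ ∑ k ∈ Finset.range n, B n k :=
        Finset.single_le_sum (fun k _ ↦ hB0 n k) (Finset.mem_range.2 hk)
      have h4 : |c n| * B n k * 2 ^ n ≤ l n := by
        have h5 : |c n| * B n k ≤ (1 + |c n|) * (1 + ∑ k ∈ Finset.range n, B n k) := by
          have := abs_nonneg (c n)
          have := hB0 n k
          apply mul_le_mul <;> linarith
        calc |c n| * B n k * 2 ^ n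
            ≤ (1 + |c n|) * (1 + ∑ k ∈ Finset.range n, B n k) * 2 ^ n := by gcongr
          _ = l n := by simp only [l]; ring
      have hp := pow_pos (hl0 n) k
      calc |a n| * (l n ^ k * B n k) ≤ |c n| / l n ^ n * (l n ^ k * B n k) := by
            have := hB0 n k
            gcongr
        _ ≤ |c n| / l n ^ (k + 1) * (l n ^ k * B n k) := by
            have := hB0 n k
            have := hl0 n
            gcongr
        _ = |c n| * B n k / l n := by
            rw [pow_succ]
            field_simp
        _ ≤ (1 / 2) ^ n := by
            rw [div_le_iff₀ (hl0 n), one_div, inv_pow, inv_mul_eq_div, le_div_iff₀ (by positivity)]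
            exact h4
    · simp [v, hk]
  refine ⟨fun x ↦ ∑' n, φ n x, contDiff_tsum hφ hv hvb, fun k ↦ ?_⟩
  rw [iteratedDeriv_eq_iteratedFDeriv, iteratedFDeriv_tsum_apply hφ hv hvb le_top]
  have hsum : Summable fun n ↦ iteratedFDeriv ℝ k (φ n) 0 :=
    .of_norm_bounded (hv k le_top) fun n ↦ hvb k n 0 le_top
  have hψ0 : ∀ n, iteratedDeriv k (ψ n) 0 = if k = n then (n.factorial : ℝ) else 0 := by
    intro n
    have : ψ n =ᶠ[𝓝 0] fun x ↦ x ^ n := by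
      filter_upwards [χ.eventuallyEq_one] with x hx
      simp [ψ, hx]
    rw [this.iteratedDeriv_eq, iteratedDeriv_fun_pow_zero]
    split_ifs <;> simp
  have hmap := (ContinuousMultilinearMap.apply ℝ (fun _ : Fin k ↦ ℝ) ℝ fun _ ↦ 1).map_tsum hsum
  refine hmap.trans ?_
  simp only [ContinuousMultilinearMap.apply_apply, ← iteratedDeriv_eq_iteratedFDeriv, hφd, mul_zero,
    hψ0]
  rw [tsum_eq_single k]
  · have := (pow_pos (hl0 k) k).ne'
    have : (k.factorial : ℝ) ≠ 0 := by exact_mod_cast k.factorial_ne_zero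
    simp only [a, if_true]
    field_simp
  · intro n hn
    simp [hn.symm]

/-- A sequence of smooth functions with `hₙ' = 2 t hₙ₊₁` that vanish at `0` gives smooth functions
`x ↦ hₙ (√x)`. -/
theorem contDiff_comp_sqrt {h : ℕ → ℝ → ℝ} (hs : ∀ n, ContDiff ℝ ∞ (h n))
    (hd : ∀ n t, deriv (h n) t = 2 * t * h (n + 1) t) (h0 : ∀ n, h n 0 = 0) (n : ℕ) :
    ContDiff ℝ ∞ fun x ↦ h n √x := by
  have key : ∀ n x, HasDerivAt (fun x ↦ h n √x) (h (n + 1) √x) x := by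
    intro n x
    rcases lt_trichotomy x 0 with hx | rfl | hx
    -- On the negative axis `√` takes the value `0`, so the function vanishes identically there.
    · rw [Real.sqrt_eq_zero_of_nonpos hx.le, h0]
      refine (hasDerivAt_const x (0 : ℝ)).congr_of_eventuallyEq ?_
      filter_upwards [gt_mem_nhds hx] with y hy
      rw [Real.sqrt_eq_zero_of_nonpos hy.le, h0]
    -- Integrating `2 r h (n + 1) r` up to `√x` produces the factor `x`. The difference quotient at
    -- `0` is therefore a continuous function with value `0` there.
    · have hrep : ∀ x, h n √x = x * (2 * weightedAverage 1 (h (n + 1)) √x) := by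
        intro x
        rcases le_total 0 x with hx | hx
        · have h1 : h n √x - h n 0 = ∫ r in (0 : ℝ)..√x, deriv (h n) r :=
            (intervalIntegral.integral_deriv_eq_sub (fun s _ ↦ ((hs n).differentiable (by simp)) s)
              (((hs n).continuous_deriv (by simp)).intervalIntegrable _ _)).symm
          have h2 : ∫ r in (0 : ℝ)..√x, deriv (h n) r =
              2 * ∫ r in (0 : ℝ)..√x, r • h (n + 1) r := by
            rw [← intervalIntegral.integral_const_mul]
            simp only [hd, smul_eq_mul, mul_assoc]
          rw [h2, integral_smul_eq_weightedAverage, Real.sq_sqrt hx, h0, sub_zero] at h1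
          rw [h1, smul_eq_mul]
          ring
        · rw [Real.sqrt_eq_zero_of_nonpos hx, h0, weightedAverage_zero_right zero_le_one, h0]
          simp
      rw [hasDerivAt_iff_tendsto_slope]
      have hc : Continuous fun x ↦ 2 * weightedAverage 1 (h (n + 1)) √x :=
        continuous_const.mul ((contDiff_weightedAverage zero_le_one (hs (n + 1))).continuous.comp
          Real.continuous_sqrt)
      have h3 := (hc.tendsto 0).mono_left (nhdsWithin_le_nhds (s := {0}ᶜ))
      rw [Real.sqrt_zero, weightedAverage_zero_right zero_le_one, h0] at h3
      rw [Real.sqrt_zero, h0]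
      simp only [smul_zero, mul_zero] at h3
      refine h3.congr' ?_
      filter_upwards [self_mem_nhdsWithin] with y hy
      rw [slope_def_field, hrep y, hrep 0]
      have : y ≠ 0 := hy
      field_simp
      simp
    · have h1 := ((hs n).differentiable (by simp) √x).hasDerivAt.comp x (Real.hasDerivAt_sqrt hx.ne')
      refine h1.congr_deriv ?_
      rw [hd]
      have := (Real.sqrt_pos.2 hx).ne'
      field_simp
  rw [contDiff_infty]
  intro m
  induction m generalizing n with
  | zero =>
    exact contDiff_zero.2 (continuous_iff_continuousAt.2 fun t ↦ (key n t).continuousAt)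
  | succ m ih =>
    rw [Nat.cast_add, Nat.cast_one, contDiff_succ_iff_deriv]
    refine ⟨fun t ↦ (key n t).differentiableAt, by simp, ?_⟩
    rw [show deriv (fun x ↦ h n √x) = fun x ↦ h (n + 1) √x from funext fun t ↦ (key n t).deriv]
    exact ih (n + 1)

/-- **Whitney's theorem**: a smooth even function is a smooth function of the square. -/
theorem exists_contDiff_comp_sq {f : ℝ → ℝ} (hf : ContDiff ℝ ∞ f) (he : ∀ t, f (-t) = f t) :
    ∃ g : ℝ → ℝ, ContDiff ℝ ∞ g ∧ ∀ t, f t = g (t ^ 2) := by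
  -- The derivative of an even function is odd, so it is `t` times a smooth even function. Iterating
  -- gives the functions that `d/d(t ^ 2)` should produce.
  have step : ∀ f : {f : ℝ → ℝ // ContDiff ℝ ∞ f ∧ ∀ t, f (-t) = f t},
      ∃ k : {f : ℝ → ℝ // ContDiff ℝ ∞ f ∧ ∀ t, f (-t) = f t},
        ∀ t, deriv f.1 t = 2 * t * k.1 t := by
    rintro ⟨f, hf, he⟩
    have hdf := (contDiff_infty_iff_deriv.1 hf).2
    have hodd : ∀ t, deriv f (-t) = -deriv f t := fun t ↦ by
      have := deriv_comp_neg f t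
      rw [show (fun x ↦ f (-x)) = f from funext he] at this
      linarith
    have heven : ∀ t, deriv (deriv f) (-t) = deriv (deriv f) t := fun t ↦ by
      have := deriv_comp_neg (deriv f) t
      rw [show (fun x ↦ deriv f (-x)) = fun x ↦ -deriv f x from funext hodd, deriv.fun_neg] at this
      linarith
    have hodd0 : deriv f 0 = 0 := by
      have := hodd 0
      rw [neg_zero] at this
      linarith
    refine ⟨⟨fun t ↦ 2⁻¹ * weightedAverage 0 (deriv (deriv f)) t, contDiff_const.mul
      (contDiff_weightedAverage le_rfl (contDiff_infty_iff_deriv.1 hdf).2), fun t ↦ ?_⟩, fun t ↦ ?_⟩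
    · simp only [weightedAverage, mul_neg, heven]
    · have := sub_eq_smul_weightedAverage hdf t
      rw [hodd0, sub_zero, smul_eq_mul] at this
      rw [this]
      ring
  choose T hT using step
  let F : ℕ → {f : ℝ → ℝ // ContDiff ℝ ∞ f ∧ ∀ t, f (-t) = f t} := fun n ↦ T^[n] ⟨f, hf, he⟩
  have hF : ∀ n t, deriv (F n).1 t = 2 * t * (F (n + 1)).1 t := fun n t ↦ by
    simp only [F, Function.iterate_succ_apply']
    exact hT _ t
  -- Borel's lemma provides the Taylor series at `0` that the sought function of `t ^ 2` must have.
  -- After subtracting it, every member of the sequence vanishes at `0`, as `contDiff_comp_sqrt`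
  -- requires.
  obtain ⟨g, hg, hg0⟩ := exists_contDiff_iteratedDeriv_eq fun n ↦ (F n).1 0
  have hgn : ∀ n, ContDiff ℝ ∞ (iteratedDeriv n g) := fun n ↦ by
    induction n with
    | zero => simpa using hg
    | succ n ih =>
      rw [iteratedDeriv_succ]
      exact (contDiff_infty_iff_deriv.1 ih).2
  have hsm := contDiff_comp_sqrt (h := fun n t ↦ (F n).1 t - iteratedDeriv n g (t ^ 2))
    (fun n ↦ (F n).2.1.sub ((hgn n).comp (contDiff_id.pow 2)))
    (fun n t ↦ by
      have h1 : HasDerivAt (F n).1 (2 * t * (F (n + 1)).1 t) t := by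
        rw [← hF]
        exact ((F n).2.1.differentiable (by simp) t).hasDerivAt
      have h2 := (((hgn n).differentiable (by simp) (t ^ 2)).hasDerivAt).comp t (hasDerivAt_pow 2 t)
      rw [← iteratedDeriv_succ] at h2
      refine (h1.sub h2).deriv.trans ?_
      push_cast
      ring)
    (fun n ↦ by simp [hg0]) 0
  refine ⟨_, hg.add hsm, fun t ↦ ?_⟩
  have h1 : (F 0).1 |t| = f t := by
    rcases abs_choice t with h | h <;> rw [h]
    · rfl
    · exact he t
  simp [Real.sqrt_sq_eq_abs, h1]

/-! ### Local diffeomorphisms. -/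

section LocalDiffeomorphisms

/-- The inverse function theorem for smooth maps of normed spaces. -/
theorem isLocalDiffeomorphAt_of_hasFDerivAt {E F : Type*} [NormedAddCommGroup E] [NormedSpace ℝ E]
    [CompleteSpace E] [NormedAddCommGroup F] [NormedSpace ℝ F] {f : E → F} {x : E}
    (hf : ∀ᶠ y in 𝓝 x, ContDiffAt ℝ ∞ f y) {f' : E ≃L[ℝ] F}
    (hf' : HasFDerivAt f (f' : E →L[ℝ] F) x) :
    IsLocalDiffeomorphAt 𝓘(ℝ, E) 𝓘(ℝ, F) ∞ f x := by
  have h0 : ContDiffAt ℝ ∞ f x := hf.self_of_nhds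
  -- Invertible operators form an open set. Smoothness of the inverse is needed at every point of
  -- the target, so the derivative must be invertible on a whole neighbourhood.
  have hinv : ∀ᶠ y in 𝓝 x, ∃ g' : E ≃L[ℝ] F, HasFDerivAt f (g' : E →L[ℝ] F) y := by
    have h1 : Set.range ((↑) : (E ≃L[ℝ] F) → E →L[ℝ] F) ∈ 𝓝 (fderiv ℝ f x) := by
      rw [hf'.fderiv]
      exact f'.nhds
    filter_upwards [hf, (h0.continuousAt_fderiv (by simp)).eventually h1] with y hy hy'
    obtain ⟨g', hg'⟩ := hy'
    exact ⟨g', hg' ▸ (hy.differentiableAt (by simp)).hasFDerivAt⟩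
  obtain ⟨W, hW, hWo, hxW⟩ := eventually_nhds_iff.1 (hf.and hinv)
  let e := h0.toOpenPartialHomeomorph f hf' (by simp)
  have hxe : x ∈ e.source := h0.mem_toOpenPartialHomeomorph_source hf' (by simp)
  let e' := e.restrOpen W hWo
  have he' : ∀ y, e' y = f y := fun y ↦ rfl
  have hs : ∀ y ∈ e'.source, y ∈ W := fun y hy ↦ by
    rw [OpenPartialHomeomorph.restrOpen_source] at hy
    exact hy.2
  refine ⟨⟨e'.toPartialEquiv, e'.open_source, e'.open_target, fun y hy ↦ ?_, fun y hy ↦ ?_⟩, ?_, ?_⟩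
  · exact (hW y (hs y hy)).1.contMDiffAt.contMDiffWithinAt
  · obtain ⟨h1, g', hg'⟩ := hW _ (hs _ (e'.map_target hy))
    exact (e'.contDiffAt_symm hy hg' h1).contMDiffAt.contMDiffWithinAt
  · exact (OpenPartialHomeomorph.restrOpen_source e W hWo).symm ▸ ⟨hxe, hxW⟩
  · exact fun y _ ↦ rfl

theorem isLocalDiffeomorphAt_extChartAt {M : Type*} [TopologicalSpace M] [ChartedSpace Plane M]
    [IsManifold (𝓡 2) ∞ M] (p : M) :
    IsLocalDiffeomorphAt (𝓡 2) 𝓘(ℝ, Plane) ∞ (extChartAt (𝓡 2) p) p :=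
  ⟨⟨extChartAt (𝓡 2) p, isOpen_extChartAt_source p, isOpen_extChartAt_target p,
    by rw [extChartAt_source]; exact contMDiffOn_extChartAt, contMDiffOn_extChartAt_symm p⟩,
    mem_extChartAt_source p, fun _ _ ↦ rfl⟩

variable {E F : Type*} [NormedAddCommGroup E] [NormedSpace ℝ E] [NormedAddCommGroup F]
  [NormedSpace ℝ F]

theorem IsLocalDiffeomorphAt.eventually_contDiffAt {f : E → F} {x : E}
    (hf : IsLocalDiffeomorphAt 𝓘(ℝ, E) 𝓘(ℝ, F) ∞ f x) : ∀ᶠ y in 𝓝 x, ContDiffAt ℝ ∞ f y := by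
  obtain ⟨Φ, hx, h⟩ := hf
  filter_upwards [Φ.open_source.mem_nhds hx] with y hy
  exact (IsLocalDiffeomorphAt.contMDiffAt ⟨Φ, hy, h⟩).contDiffAt

theorem IsLocalDiffeomorphAt.injective_fderiv {f : E → F} {x : E}
    (hf : IsLocalDiffeomorphAt 𝓘(ℝ, E) 𝓘(ℝ, F) ∞ f x) : Function.Injective (fderiv ℝ f x) := by
  have h1 : HasFDerivAt f (fderiv ℝ f x) x :=
    (hf.eventually_contDiffAt.self_of_nhds.differentiableAt (by simp)).hasFDerivAt
  have h2 : DifferentiableAt ℝ hf.localInverse (f x) :=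
    (hf.localInverse_contMDiffAt.contDiffAt).differentiableAt (by simp)
  have h3 := (h2.hasFDerivAt.comp x h1).congr_of_eventuallyEq
    hf.localInverse_eventuallyEq_left.symm
  have h4 := h3.unique (hasFDerivAt_id x)
  intro u v huv
  have hu := DFunLike.congr_fun h4 u
  have hv := DFunLike.congr_fun h4 v
  simp only [ContinuousLinearMap.comp_apply, huv] at hu hv
  exact hu.symm.trans hv

end LocalDiffeomorphisms

/-! ### Normal form of a plane cusp. -/

section Plane

/-- The determinant of two vectors of the plane. -/
def det₂ (u v : Plane) : ℝ := u 0 * v 1 - u 1 * v 0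

theorem det₂_map_ne_zero {A : ℝ × ℝ →L[ℝ] Plane} (hA : Function.Injective A) :
    det₂ (A (1, 0)) (A (0, 1)) ≠ 0 := by
  intro h
  set u := A (1, 0) with hu
  set v := A (0, 1) with hv
  have hab : ∀ a b : ℝ, a • u + b • v = 0 → a = 0 ∧ b = 0 := by
    intro a b hz
    have h1 : A (a, b) = A 0 := by
      rw [map_zero, ← hz, hu, hv, ← map_smul, ← map_smul, ← map_add]
      simp
    exact Prod.ext_iff.1 (hA h1)
  rw [det₂] at h
  have h1 := hab (v 1) (-u 1) (by
    ext i
    fin_cases i <;> simp <;> linarith)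
  have h2 := hab (v 0) (-u 0) (by
    ext i
    fin_cases i <;> simp <;> linarith)
  have h3 := hab 1 0 (by
    ext i
    fin_cases i <;> simp <;> linarith [h1.2, h2.2])
  exact one_ne_zero h3.1

/-- The coordinates with respect to a basis `(u, v)` of the plane. -/
noncomputable def basisCoord {u v : Plane} (h : det₂ u v ≠ 0) : Plane ≃L[ℝ] ℝ × ℝ :=
  LinearEquiv.toContinuousLinearEquiv
    { toFun := fun d ↦ (det₂ d v / det₂ u v, det₂ u d / det₂ u v)
      map_add' := fun d e ↦ by
        ext <;> simp [det₂] <;> ring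
      map_smul' := fun a d ↦ by
        ext <;> simp [det₂] <;> ring
      invFun := fun z ↦ z.1 • u + z.2 • v
      left_inv := fun d ↦ by
        ext i
        change det₂ d v / det₂ u v * u i + det₂ u d / det₂ u v * v i = d i
        rw [div_mul_eq_mul_div, div_mul_eq_mul_div, ← add_div, div_eq_iff h]
        fin_cases i <;> simp only [det₂, Fin.zero_eta, Fin.mk_one] <;> ring
      right_inv := fun z ↦ by
        ext
        · change det₂ (z.1 • u + z.2 • v) v / det₂ u v = z.1
          rw [div_eq_iff h]
          simp only [det₂, PiLp.add_apply, PiLp.smul_apply, smul_eq_mul]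
          ring
        · change det₂ u (z.1 • u + z.2 • v) / det₂ u v = z.2
          rw [div_eq_iff h]
          simp only [det₂, PiLp.add_apply, PiLp.smul_apply, smul_eq_mul]
          ring }

theorem basisCoord_apply {u v : Plane} (h : det₂ u v ≠ 0) (d : Plane) :
    basisCoord h d = (det₂ d v / det₂ u v, det₂ u d / det₂ u v) := rfl

end Plane

theorem SmoothGerm.eventuallyEq_of_deriv_eq {E : Type*} [NormedAddCommGroup E] [NormedSpace ℝ E]
    {f g : ℝ → E} (hf : SmoothGerm f) (hg : SmoothGerm g)
    (h : _root_.deriv f =ᶠ[𝓝 0] _root_.deriv g) (h0 : f 0 = g 0) : f =ᶠ[𝓝 0] g := by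
  obtain ⟨ε, hε, hb⟩ := Metric.eventually_nhds_iff_ball.1
    ((hf.eventually_differentiableAt.and hg.eventually_differentiableAt).and h)
  filter_upwards [Metric.ball_mem_nhds 0 hε] with t ht
  exact Metric.isOpen_ball.eqOn_of_deriv_eq (convex_ball 0 ε).isPreconnected
    (fun s hs ↦ (hb s hs).1.1.differentiableWithinAt)
    (fun s hs ↦ (hb s hs).1.2.differentiableWithinAt) (fun s hs ↦ (hb s hs).2)
    (Metric.mem_ball_self hε) h0 ht

/-- A plane curve of the form `s ↦ (s², s³ m(s))` with `m 0 ≠ 0` is taken to `s ↦ (s², s³)` by a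
local diffeomorphism. -/
theorem exists_isLocalDiffeomorphAt_cusp {m : ℝ → ℝ} (hm : SmoothGerm m) (h0 : m 0 ≠ 0) :
    ∃ H : ℝ × ℝ → ℝ × ℝ, IsLocalDiffeomorphAt 𝓘(ℝ, ℝ × ℝ) 𝓘(ℝ, ℝ × ℝ) ∞ H 0 ∧
      ∀ᶠ s in 𝓝 (0 : ℝ), H (s ^ 2, s ^ 3 * m s) = (s ^ 2, s ^ 3) := by
  obtain ⟨n, hn, hnm⟩ := hm.exists_contDiff
  have hneg : ContDiff ℝ ∞ fun s : ℝ ↦ n (-s) := hn.comp contDiff_neg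
  -- Even and odd parts: `n s = a (s ^ 2) + s * b (s ^ 2)`.
  obtain ⟨a, ha, han⟩ := exists_contDiff_comp_sq (f := fun s ↦ 2⁻¹ * (n s + n (-s)))
    (contDiff_const.mul (hn.add hneg)) (fun t ↦ by simp only [neg_neg]; ring)
  let o : ℝ → ℝ := fun s ↦ 2⁻¹ * (n s - n (-s))
  have ho : ContDiff ℝ ∞ o := contDiff_const.mul (hn.sub hneg)
  have hod : ∀ t, deriv o (-t) = deriv o t := fun t ↦ by
    have h1 := deriv_comp_neg o t
    rw [show (fun x ↦ o (-x)) = fun x ↦ -o x from funext fun x ↦ by simp only [o, neg_neg]; ring,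
      deriv.fun_neg] at h1
    linarith
  obtain ⟨b, hb, hbn⟩ := exists_contDiff_comp_sq (f := weightedAverage 0 (deriv o))
    (contDiff_weightedAverage le_rfl (contDiff_infty_iff_deriv.1 ho).2)
    (fun t ↦ by simp only [weightedAverage, mul_neg, hod])
  have hdec : ∀ s, n s = a (s ^ 2) + s * b (s ^ 2) := fun s ↦ by
    have h1 := sub_eq_smul_weightedAverage ho s
    rw [hbn, smul_eq_mul] at h1
    rw [← han, ← h1]
    simp only [o, neg_zero, sub_self, mul_zero, sub_zero]
    ring
  have ha0 : a 0 ≠ 0 := by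
    have := han 0
    simp only [neg_zero] at this
    rw [hnm.eq_of_nhds] at this
    norm_num at this
    rw [← this]
    intro h
    apply h0
    linarith
  -- Since `s ^ 3 * n s = a (s ^ 2) * s ^ 3 + (s ^ 2) ^ 2 * b (s ^ 2)`, this map sends `(s ^ 2, s ^
  -- 3)` to the given curve; `H` is its local inverse.
  let G : ℝ × ℝ → ℝ × ℝ := fun z ↦ (z.1, a z.1 * z.2 + z.1 ^ 2 * b z.1)
  have hG : ContDiff ℝ ∞ G := contDiff_fst.prodMk
    (((ha.comp contDiff_fst).mul contDiff_snd).add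
      ((contDiff_fst.pow 2).mul (hb.comp contDiff_fst)))
  have hG0 : G 0 = 0 := by simp [G]
  let e : (ℝ × ℝ) ≃L[ℝ] ℝ × ℝ := (ContinuousLinearEquiv.refl ℝ ℝ).prodCongr
    (ContinuousLinearEquiv.unitsEquivAut ℝ (Units.mk0 (a 0) ha0))
  have hGd : HasFDerivAt G (e : ℝ × ℝ →L[ℝ] ℝ × ℝ) 0 := by
    have h1 : HasFDerivAt (fun z : ℝ × ℝ ↦ z.1) (ContinuousLinearMap.fst ℝ ℝ ℝ) 0 := hasFDerivAt_fst
    have h2 : HasFDerivAt (fun z : ℝ × ℝ ↦ z.2) (ContinuousLinearMap.snd ℝ ℝ ℝ) 0 := hasFDerivAt_snd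
    have h3 : HasFDerivAt (fun z : ℝ × ℝ ↦ a z.1) _ 0 :=
      ((ha.differentiable (by simp) _).hasDerivAt).comp_hasFDerivAt (0 : ℝ × ℝ) h1
    have h4 : HasFDerivAt (fun z : ℝ × ℝ ↦ b z.1) _ 0 :=
      ((hb.differentiable (by simp) _).hasDerivAt).comp_hasFDerivAt (0 : ℝ × ℝ) h1
    refine (h1.prodMk ((h3.mul h2).add ((h1.pow 2).mul h4))).congr_fderiv ?_
    ext <;> simp [e]
  have hGl := isLocalDiffeomorphAt_of_hasFDerivAt
    (Eventually.of_forall fun z ↦ hG.contDiffAt) hGd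
  refine ⟨hGl.localInverse, ?_, ?_⟩
  · have := hGl.localInverse_isLocalDiffeomorphAt
    rwa [hG0] at this
  · have ht : Tendsto (fun s : ℝ ↦ (s ^ 2, s ^ 3)) (𝓝 0) (𝓝 (0 : ℝ × ℝ)) := by
      have : Continuous fun s : ℝ ↦ (s ^ 2, s ^ 3) := by fun_prop
      simpa using! this.tendsto 0
    filter_upwards [ht.eventually hGl.localInverse_eventuallyEq_left, hnm] with s h1 h2
    rw [← h2, hdec]
    refine Eq.trans (congrArg _ ?_) h1
    simp only [G]
    ring_nf

theorem SmoothGerm.localInverse {c : ℝ → ℝ} {t : ℝ}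
    (hc : IsLocalDiffeomorphAt 𝓘(ℝ, ℝ) 𝓘(ℝ, ℝ) ∞ c t) (h0 : c t = 0) :
    SmoothGerm hc.localInverse := by
  have := hc.localInverse_isLocalDiffeomorphAt.eventually_contDiffAt
  rwa [h0] at this

theorem deriv_mul_deriv_eq_one {c d : ℝ → ℝ} (hc : DifferentiableAt ℝ c (d 0))
    (hd : DifferentiableAt ℝ d 0) (h : ∀ᶠ t in 𝓝 (0 : ℝ), c (d t) = t) :
    deriv c (d 0) * deriv d 0 = 1 := by
  have h1 := (hc.hasDerivAt.comp 0 hd.hasDerivAt).congr_of_eventuallyEq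
    (EventuallyEq.symm (show c ∘ d =ᶠ[𝓝 0] fun t ↦ t from h))
  exact h1.unique (hasDerivAt_id 0)

/-- A curve in the plane whose velocity is `t Y(t)` with `Y(0)` and `Y'(0)` linearly independent
becomes `s ↦ (s², s³)` after changes of the parameter and of the coordinates. -/
theorem exists_cusp_normal_form {x Y : ℝ → Plane} (hx : SmoothGerm x) (hY : SmoothGerm Y)
    (hxY : deriv x =ᶠ[𝓝 0] fun t ↦ t • Y t) (h0 : det₂ (Y 0) (deriv Y 0) ≠ 0) :
    ∃ (c : ℝ → ℝ) (H : Plane → ℝ × ℝ), c 0 = 0 ∧ IsLocalDiffeomorphAt 𝓘(ℝ, ℝ) 𝓘(ℝ, ℝ) ∞ c 0 ∧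
      IsLocalDiffeomorphAt 𝓘(ℝ, Plane) 𝓘(ℝ, ℝ × ℝ) ∞ H (x 0) ∧
      ∀ᶠ s in 𝓝 (0 : ℝ), H (x (c s)) = (s ^ 2, s ^ 3) := by
  obtain ⟨Z, hZ, hZY⟩ := hY.exists_contDiff
  let y : ℝ → Plane := weightedAverage 1 Z
  have hy : ContDiff ℝ ∞ y := contDiff_weightedAverage zero_le_one hZ
  have hxy : x =ᶠ[𝓝 0] fun t ↦ x 0 + t ^ 2 • y t := by
    refine hx.eventuallyEq_of_deriv_eq
      ((SmoothGerm.const _).add ((SmoothGerm.id.pow 2).smul hy.smoothGerm)) ?_ (by simp)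
    filter_upwards [hxY, hZY] with t h1 h2
    have h3 : (fun t ↦ x 0 + t ^ 2 • y t) = fun t ↦ x 0 + ∫ r in (0 : ℝ)..t, r • Z r := by
      funext t
      rw [integral_smul_eq_weightedAverage]
    have hc : Continuous fun r : ℝ ↦ r • Z r := continuous_id.smul hZ.continuous
    rw [h1, h3, ← h2]
    exact ((hc.integral_hasStrictDerivAt 0 t).hasDerivAt.const_add (x 0)).deriv.symm
  have hy0 : y 0 = (2⁻¹ : ℝ) • Y 0 := by
    simp only [y]
    rw [weightedAverage_zero_right zero_le_one, hZY.eq_of_nhds]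
    norm_num
  have hy1 : deriv y 0 = (3⁻¹ : ℝ) • deriv Y 0 := by
    rw [(hasDerivAt_weightedAverage zero_le_one hZ 0).deriv,
      weightedAverage_zero_right (by norm_num), hZY.deriv_eq]
    norm_num
  -- The averages with weights `r` and `r ^ 2` contribute `1/2` and `1/3`, hence the factor `1/6`.
  have hδ : det₂ (y 0) (deriv y 0) ≠ 0 := by
    have : det₂ (y 0) (deriv y 0) = 6⁻¹ * det₂ (Y 0) (deriv Y 0) := by
      rw [hy0, hy1]
      simp only [det₂, PiLp.smul_apply, smul_eq_mul]
      ring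
    rw [this]
    exact mul_ne_zero (by norm_num) h0
  let L := basisCoord hδ
  have hL : ContDiff ℝ ∞ fun t ↦ L (y t) := L.contDiff.comp hy
  let a : ℝ → ℝ := fun t ↦ (L (y t)).1
  let b : ℝ → ℝ := fun t ↦ (L (y t)).2
  have ha : ContDiff ℝ ∞ a := contDiff_fst.comp hL
  have hb : ContDiff ℝ ∞ b := contDiff_snd.comp hL
  have ha0 : a 0 = 1 := by
    simp only [a, L, basisCoord_apply]
    exact div_self hδ
  have hb0 : b 0 = 0 := by
    simp only [b, L, basisCoord_apply, det₂]
    ring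
  have hb1 : deriv b 0 = 1 := by
    have h1 : HasDerivAt (fun t ↦ L (y t)) (L (deriv y 0)) 0 :=
      L.hasFDerivAt.comp_hasDerivAt 0 (hy.differentiable (by simp) 0).hasDerivAt
    have h2 : HasDerivAt b (L (deriv y 0)).2 0 :=
      (ContinuousLinearMap.snd ℝ ℝ ℝ).hasFDerivAt.comp_hasDerivAt 0 h1
    rw [h2.deriv]
    simp only [L, basisCoord_apply]
    exact div_self hδ
  let k : ℝ → ℝ := weightedAverage 0 (deriv b)
  have hk : ContDiff ℝ ∞ k := contDiff_weightedAverage le_rfl (contDiff_infty_iff_deriv.1 hb).2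
  have hbk : ∀ t, b t = t * k t := fun t ↦ by
    have := sub_eq_smul_weightedAverage hb t
    rwa [hb0, sub_zero] at this
  have hk0 : k 0 = 1 := by
    simp only [k]
    rw [weightedAverage_zero_right le_rfl, hb1]
    norm_num
  have hLx : ∀ᶠ t in 𝓝 (0 : ℝ), L (x t - x 0) = (t ^ 2 * a t, t ^ 3 * k t) := by
    filter_upwards [hxy] with t ht
    rw [ht, add_sub_cancel_left, map_smul]
    refine Prod.ext rfl ?_
    change t ^ 2 * b t = _
    rw [hbk]
    ring
  -- The new parameter, chosen so that the first coordinate `t ^ 2 * a t` is its square.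
  let σ : ℝ → ℝ := fun t ↦ t * √(a t)
  have hapos : ∀ᶠ t in 𝓝 (0 : ℝ), 0 < a t :=
    ha.continuous.continuousAt.eventually (lt_mem_nhds (by rw [ha0]; exact one_pos))
  have hsq : SmoothGerm fun t ↦ √(a t) := by
    filter_upwards [hapos] with t ht
    exact ha.contDiffAt.sqrt ht.ne'
  have hσ : SmoothGerm σ := SmoothGerm.id.mul hsq
  have hσ0 : σ 0 = 0 := by simp [σ]
  have hσd : HasDerivAt σ 1 0 := by
    have := (hasDerivAt_id (0 : ℝ)).mul hsq.differentiableAt.hasDerivAt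
    simpa [ha0] using! this
  have hσl : IsLocalDiffeomorphAt 𝓘(ℝ, ℝ) 𝓘(ℝ, ℝ) ∞ σ 0 :=
    isLocalDiffeomorphAt_of_hasFDerivAt (f' := ContinuousLinearEquiv.refl ℝ ℝ) hσ
      (hσd.hasFDerivAt.congr_fderiv (by ext; simp))
  let c : ℝ → ℝ := hσl.localInverse
  have hc : SmoothGerm c := SmoothGerm.localInverse hσl hσ0
  have hc0 : c 0 = 0 := by
    have := hσl.localInverse_eventuallyEq_left.eq_of_nhds
    simpa [hσ0] using this
  have hσc : ∀ᶠ s in 𝓝 (0 : ℝ), σ (c s) = s := by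
    have := hσl.localInverse_eventuallyEq_right
    rwa [hσ0] at this
  have hcl : IsLocalDiffeomorphAt 𝓘(ℝ, ℝ) 𝓘(ℝ, ℝ) ∞ c 0 := by
    have := hσl.localInverse_isLocalDiffeomorphAt
    rwa [hσ0] at this
  have hcd : deriv c 0 ≠ 0 := by
    have := deriv_mul_deriv_eq_one (c := σ) (d := c) (by rw [hc0]; exact hσ.differentiableAt)
      hc.differentiableAt hσc
    intro h
    rw [h, mul_zero] at this
    exact zero_ne_one this
  -- Writing `c s = s * ρ s` brings the second coordinate `c ^ 3 * k c` to the form `s ^ 3 * m s`.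
  obtain ⟨ρ, hρ, hρc, hρ0⟩ := hc.exists_eq_smul hc0
  obtain ⟨H, hH, hHc⟩ := exists_isLocalDiffeomorphAt_cusp
    (m := fun s ↦ ρ s ^ 3 * k (c s)) ((hρ.pow 3).mul (hk.smoothGerm.comp hc hc0))
    (by simp only [hc0, hk0, hρ0, mul_one]; exact pow_ne_zero 3 hcd)
  have hA : IsLocalDiffeomorphAt 𝓘(ℝ, Plane) 𝓘(ℝ, ℝ × ℝ) ∞ (fun z ↦ L (z - x 0)) (x 0) :=
    isLocalDiffeomorphAt_of_hasFDerivAt (f' := L)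
      (Eventually.of_forall fun z ↦ (L.contDiff.comp (contDiff_id.sub contDiff_const)).contDiffAt)
      (L.hasFDerivAt.comp (x 0) ((hasFDerivAt_id (x 0)).sub_const (x 0)))
  refine ⟨c, H ∘ fun z ↦ L (z - x 0), hc0, hcl, hA.comp _ _ ?_, ?_⟩
  · simpa using hH
  · have hct : Tendsto c (𝓝 0) (𝓝 0) := by simpa [hc0] using hc.continuousAt.tendsto
    filter_upwards [hct.eventually hLx, hct.eventually hapos, hσc, hρc, hHc] with s h1 h2 h3 h4 h5
    rw [Function.comp_apply, h1, ← h5]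
    congr 1
    refine Prod.ext ?_ ?_
    · have h6 : c s * √(a (c s)) = s := h3
      calc c s ^ 2 * a (c s) = (c s * √(a (c s))) ^ 2 := by rw [mul_pow, Real.sq_sqrt h2.le]
        _ = s ^ 2 := by rw [h6]
    · change c s ^ 3 * k (c s) = s ^ 3 * (ρ s ^ 3 * k (c s))
      rw [h4, smul_eq_mul, mul_pow, mul_assoc]

/-! ### Cusps on a surface characterised by their velocity. -/

section

variable {M : Type*} [TopologicalSpace M] [ChartedSpace Plane M] [IsManifold (𝓡 2) ∞ M]

theorem isThreeHalvesCusp_of_deriv_eq {γ : ℝ → M} {x Y : ℝ → Plane}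
    (hγ : ∀ᶠ t in 𝓝 (0 : ℝ), ContMDiffAt 𝓘(ℝ, ℝ) (𝓡 2) ∞ γ t)
    (hγx : ∀ᶠ t in 𝓝 (0 : ℝ), extChartAt (𝓡 2) (γ 0) (γ t) = x t)
    (hx : SmoothGerm x) (hY : SmoothGerm Y)
    (hxY : deriv x =ᶠ[𝓝 0] fun t ↦ t • Y t) (h0 : det₂ (Y 0) (deriv Y 0) ≠ 0) :
    IsThreeHalvesCusp γ := by
  obtain ⟨c, H, hc0, hc, hH, hHc⟩ := exists_cusp_normal_form hx hY hxY h0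
  refine ⟨hγ, c, H ∘ extChartAt (𝓡 2) (γ 0), hc0, hc,
    (isLocalDiffeomorphAt_extChartAt (γ 0)).comp _ _ (by rwa [hγx.self_of_nhds]), ?_⟩
  have hct : Tendsto c (𝓝 0) (𝓝 0) := by
    simpa [hc0] using hc.contMDiffAt.continuousAt.tendsto
  filter_upwards [hct.eventually hγx, hHc] with s h1 h2
  rw [Function.comp_apply, h1, h2]

/-- In the chart the curve is `G (σ ^ 2, σ ^ 3)` with a local diffeomorphism `G`, so its velocity is
`σ σ'` times `DG (2, 3 σ)`. Since `σ` is divisible by `t`, so is the velocity. -/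
theorem IsThreeHalvesCusp.exists_deriv_eq {γ : ℝ → M} (h : IsThreeHalvesCusp γ) :
    ∃ Y : ℝ → Plane, SmoothGerm Y ∧
      (deriv (fun t ↦ extChartAt (𝓡 2) (γ 0) (γ t)) =ᶠ[𝓝 0] fun t ↦ t • Y t) ∧
      det₂ (Y 0) (deriv Y 0) ≠ 0 := by
  obtain ⟨hγ, c, Φ, hc0, hc, hΦ, hcusp⟩ := h
  have hγ0 : ContinuousAt γ 0 := hγ.self_of_nhds.continuousAt
  have hΦ0 : Φ (γ 0) = 0 := by
    have := hcusp.self_of_nhds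
    rw [hc0] at this
    simpa using! this
  let σ : ℝ → ℝ := hc.localInverse
  have hσ : SmoothGerm σ := SmoothGerm.localInverse hc hc0
  have hσ0 : σ 0 = 0 := by
    have := hc.localInverse_eventuallyEq_left.eq_of_nhds
    simpa [hc0] using this
  have hcσ : ∀ᶠ t in 𝓝 (0 : ℝ), c (σ t) = t := by
    have := hc.localInverse_eventuallyEq_right
    rwa [hc0] at this
  have hσd : deriv σ 0 ≠ 0 := by
    have := deriv_mul_deriv_eq_one (c := c) (d := σ)
      (by rw [hσ0]; exact (hc.contMDiffAt.contDiffAt).differentiableAt (by simp))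
      hσ.differentiableAt hcσ
    intro h
    rw [h, mul_zero] at this
    exact zero_ne_one this
  have hσt : Tendsto σ (𝓝 0) (𝓝 0) := by simpa [hσ0] using hσ.continuousAt.tendsto
  let G : ℝ × ℝ → Plane := extChartAt (𝓡 2) (γ 0) ∘ hΦ.localInverse
  have hG : IsLocalDiffeomorphAt 𝓘(ℝ, ℝ × ℝ) 𝓘(ℝ, Plane) ∞ G 0 := by
    have h1 := hΦ.localInverse_isLocalDiffeomorphAt
    rw [hΦ0] at h1
    refine h1.comp _ _ ?_
    have h2 := hΦ.localInverse_eventuallyEq_left.eq_of_nhds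
    rw [Function.comp_apply, hΦ0] at h2
    rw [h2]
    exact isLocalDiffeomorphAt_extChartAt (γ 0)
  have hx : ∀ᶠ t in 𝓝 (0 : ℝ), extChartAt (𝓡 2) (γ 0) (γ t) = G (σ t ^ 2, σ t ^ 3) := by
    filter_upwards [hσt.eventually hcusp, hcσ,
      hγ0.eventually hΦ.localInverse_eventuallyEq_left] with t h1 h2 h3
    simp only [G, Function.comp_apply]
    rw [← h1, h2]
    exact congrArg _ h3.symm
  obtain ⟨W, hW, hWo, h0W⟩ := eventually_nhds_iff.1 hG.eventually_contDiffAt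
  have hGW : ContDiffOn ℝ ∞ G W := fun z hz ↦ (hW z hz).contDiffWithinAt
  have hGd : ContDiffOn ℝ ∞ (fderiv ℝ G) W := hGW.fderiv_of_isOpen hWo (by simp)
  let z : ℝ → ℝ × ℝ := fun t ↦ (σ t ^ 2, σ t ^ 3)
  have hz : SmoothGerm z := by
    filter_upwards [hσ] with t ht
    exact (ht.pow 2).prodMk (ht.pow 3)
  have hz0 : z 0 = 0 := by simp [z, hσ0]
  let A : ℝ → ℝ × ℝ →L[ℝ] Plane := fun t ↦ fderiv ℝ G (z t)
  have hA : SmoothGerm A := hz.comp_contDiffOn hWo hGd (by rwa [hz0])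
  let d : ℝ → ℝ × ℝ := fun t ↦ (2, 3 * σ t)
  have hd : SmoothGerm d := by
    filter_upwards [hσ] with t ht
    exact contDiffAt_const.prodMk (contDiffAt_const.mul ht)
  have hzd : ∀ t, DifferentiableAt ℝ σ t → HasDerivAt z ((σ t * deriv σ t) • d t) t := by
    intro t ht
    refine ((ht.hasDerivAt.pow 2).prodMk (ht.hasDerivAt.pow 3)).congr_deriv ?_
    ext <;> simp [d] <;> ring
  let u : ℝ → Plane := fun t ↦ A t (d t)
  have hu : SmoothGerm u := by
    filter_upwards [hA, hd] with t h1 h2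
    exact h1.clm_apply h2
  obtain ⟨ρ, hρ, hρσ, hρ0⟩ := hσ.exists_eq_smul hσ0
  have hk : SmoothGerm fun t ↦ ρ t * deriv σ t := hρ.mul hσ.deriv
  refine ⟨fun t ↦ (ρ t * deriv σ t) • u t, hk.smul hu, ?_, ?_⟩
  · have hzt : Tendsto z (𝓝 0) (𝓝 0) := by simpa [hz0] using hz.continuousAt.tendsto
    filter_upwards [hx.eventually_nhds, hσ.eventually_differentiableAt, hρσ,
      hzt.eventually hG.eventually_contDiffAt] with t h1 h2 h3 h4
    have h5 : (fun t ↦ extChartAt (𝓡 2) (γ 0) (γ t)) =ᶠ[𝓝 t] G ∘ z := h1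
    rw [h5.deriv_eq, ((h4.differentiableAt (by simp)).hasFDerivAt.comp_hasDerivAt t (hzd t h2)).deriv,
      map_smul, h3, smul_smul, smul_eq_mul, mul_assoc]
  -- The curve `(σ ^ 2, σ ^ 3)` has zero velocity at `0`, so second derivatives of `G` do not enter.
  · have hA0 : HasDerivAt A 0 0 := by
      have h1 : DifferentiableAt ℝ (fderiv ℝ G) (z 0) :=
        (hGd.contDiffAt (hWo.mem_nhds (by rwa [hz0]))).differentiableAt (by simp)
      have h2 := h1.hasFDerivAt.comp_hasDerivAt 0 (hzd 0 hσ.differentiableAt)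
      simpa [hσ0] using! h2
    have hd0 : HasDerivAt d (0, 3 * deriv σ 0) 0 :=
      (hasDerivAt_const 0 2).prodMk (hσ.differentiableAt.hasDerivAt.const_mul 3)
    have hu0 : deriv u 0 = (3 * deriv σ 0) • A 0 (0, 1) := by
      rw [(hA0.clm_apply hd0).deriv, ← map_smul]
      simp
    have hu0' : u 0 = (2 : ℝ) • A 0 (1, 0) := by
      simp only [u, d, hσ0]
      rw [← map_smul]
      simp
    have hdet : det₂ (A 0 (1, 0)) (A 0 (0, 1)) ≠ 0 := by
      refine det₂_map_ne_zero ?_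
      simp only [A, hz0]
      exact hG.injective_fderiv
    have hY := (hk.differentiableAt.hasDerivAt.smul hu.differentiableAt.hasDerivAt).deriv
    have hY' : deriv (fun t ↦ (ρ t * deriv σ t) • u t) 0 = _ := hY
    rw [hY', hu0, hu0', hρ0]
    beta_reduce
    rw [hu0', hρ0]
    have : det₂ ((deriv σ 0 * deriv σ 0) • (2 : ℝ) • A 0 (1, 0))
        ((deriv σ 0 * deriv σ 0) • (3 * deriv σ 0) • A 0 (0, 1) +
          deriv (fun t ↦ ρ t * deriv σ t) 0 • (2 : ℝ) • A 0 (1, 0)) =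
        6 * deriv σ 0 ^ 5 * det₂ (A 0 (1, 0)) (A 0 (0, 1)) := by
      simp only [det₂, PiLp.add_apply, PiLp.smul_apply, smul_eq_mul]
      ring
    rw [this]
    exact mul_ne_zero (mul_ne_zero (by norm_num) (pow_ne_zero 5 hσd)) hdet

end

/-! ### Brackets of the derivatives of a cusp. -/

namespace PlanarEquiAffine

variable {L : PlanarEquiAffine}

theorem nabla_add {x ξ η : ℝ → Plane} {t : ℝ} (hξ : DifferentiableAt ℝ ξ t)
    (hη : DifferentiableAt ℝ η t) :
    L.nabla x (fun t ↦ ξ t + η t) t = L.nabla x ξ t + L.nabla x η t := by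
  simp only [nabla]
  rw [deriv_fun_add hξ hη]
  simp only [PiLp.add_apply, add_mul, add_smul, Finset.sum_add_distrib]
  abel

theorem nabla_smul {x ξ : ℝ → Plane} {a : ℝ → ℝ} {t : ℝ} (ha : DifferentiableAt ℝ a t)
    (hξ : DifferentiableAt ℝ ξ t) :
    L.nabla x (fun t ↦ a t • ξ t) t = deriv a t • ξ t + a t • L.nabla x ξ t := by
  simp only [nabla]
  rw [deriv_fun_smul ha hξ]
  simp only [PiLp.smul_apply, smul_eq_mul, mul_assoc, mul_smul, smul_add, Finset.smul_sum]
  abel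

theorem area_self (x ξ : ℝ → Plane) (t : ℝ) : L.area x ξ ξ t = 0 := by
  rw [area]
  ring

/-- The trace of the connection in the derivative of the density cancels the Christoffel terms of
the two covariant derivatives. -/
theorem hasDerivAt_area {x ξ η : ℝ → Plane} {t : ℝ} (hx : DifferentiableAt ℝ x t)
    (hU : x t ∈ L.U) (hξ : DifferentiableAt ℝ ξ t) (hη : DifferentiableAt ℝ η t) :
    HasDerivAt (L.area x ξ η) (L.area x (L.nabla x ξ) η t + L.area x ξ (L.nabla x η) t) t := by
  have hc : ∀ {ζ : ℝ → Plane}, DifferentiableAt ℝ ζ t → ∀ i,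
      HasDerivAt (fun t ↦ ζ t i) (deriv ζ t i) t := fun hζ i ↦
    (EuclideanSpace.proj (𝕜 := ℝ) i : Plane →L[ℝ] ℝ).hasFDerivAt.comp_hasDerivAt t hζ.hasDerivAt
  have hd : HasDerivAt (fun t ↦ L.dens (x t)) (fderiv ℝ L.dens (x t) (deriv x t)) t :=
    (((L.smooth_dens.contDiffAt (L.isOpen_U.mem_nhds hU)).differentiableAt
      (by simp)).hasFDerivAt).comp_hasDerivAt t hx.hasDerivAt
  refine (hd.mul (((hc hξ 0).mul (hc hη 1)).sub ((hc hξ 1).mul (hc hη 0)))).congr_deriv ?_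
  rw [L.parallel _ hU]
  simp only [area, nabla, Fin.sum_univ_two, PiLp.add_apply, PiLp.smul_apply, smul_eq_mul,
    Pi.sub_apply, Pi.mul_apply]
  ring

/-- Brackets of the derivatives of a curve with velocity `t ↦ t • Y t`. -/
theorem area_curveDeriv_of_deriv_eq {x Y : ℝ → Plane} (hx : SmoothGerm x) (h0 : x 0 ∈ L.U)
    (hY : SmoothGerm Y) (hxY : deriv x =ᶠ[𝓝 0] fun t ↦ t • Y t) {Y₁ Y₂ Y₃ : ℝ → Plane}
    (h₁ : Y₁ =ᶠ[𝓝 0] L.nabla x Y) (h₂ : Y₂ =ᶠ[𝓝 0] L.nabla x Y₁) (h₃ : Y₃ =ᶠ[𝓝 0] L.nabla x Y₂) :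
    (L.area x (L.curveDeriv x 0) (L.curveDeriv x 1) =ᶠ[𝓝 0] fun t ↦ t ^ 2 * L.area x Y Y₁ t) ∧
    (L.area x (L.curveDeriv x 0) (L.curveDeriv x 2) =ᶠ[𝓝 0]
      fun t ↦ 2 * t * L.area x Y Y₁ t + t ^ 2 * L.area x Y Y₂ t) ∧
    (L.area x (L.curveDeriv x 0) (L.curveDeriv x 3) =ᶠ[𝓝 0]
      fun t ↦ 3 * t * L.area x Y Y₂ t + t ^ 2 * L.area x Y Y₃ t) ∧
    (L.area x (L.curveDeriv x 1) (L.curveDeriv x 2) =ᶠ[𝓝 0]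
      fun t ↦ 2 * L.area x Y Y₁ t + t * L.area x Y Y₂ t + t ^ 2 * L.area x Y₁ Y₂ t) := by
  have hY₁ : SmoothGerm Y₁ := (smoothGerm_nabla hx h0 hY).congr h₁.symm
  have hY₂ : SmoothGerm Y₂ := (smoothGerm_nabla hx h0 hY₁).congr h₂.symm
  have e0 : L.curveDeriv x 0 =ᶠ[𝓝 0] fun t ↦ t • Y t := hxY
  have key : ∀ {ξ : ℝ → Plane}, SmoothGerm ξ →
      L.nabla x (fun t ↦ t • ξ t) =ᶠ[𝓝 0] fun t ↦ ξ t + t • L.nabla x ξ t := fun hξ ↦ by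
    filter_upwards [hξ.eventually_differentiableAt] with t ht
    rw [nabla_smul differentiableAt_fun_id ht, deriv_id'', one_smul]
  have key2 : ∀ {ξ η : ℝ → Plane}, SmoothGerm ξ → SmoothGerm η →
      L.nabla x (fun t ↦ ξ t + t • η t) =ᶠ[𝓝 0]
        fun t ↦ L.nabla x ξ t + (η t + t • L.nabla x η t) := fun hξ hη ↦ by
    filter_upwards [hξ.eventually_differentiableAt,
      (SmoothGerm.id.smul hη).eventually_differentiableAt, key hη] with t h1 h2 h3
    rw [nabla_add h1 h2, h3]
  have e1 : L.curveDeriv x 1 =ᶠ[𝓝 0] fun t ↦ Y t + t • Y₁ t := by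
    refine (nabla_congr e0).trans ((key hY).trans ?_)
    filter_upwards [h₁] with t ht
    rw [ht]
  have e2 : L.curveDeriv x 2 =ᶠ[𝓝 0] fun t ↦ (2 : ℝ) • Y₁ t + t • Y₂ t := by
    refine (nabla_congr e1).trans ((key2 hY hY₁).trans ?_)
    filter_upwards [h₁, h₂] with t ht ht'
    rw [← ht, ← ht', two_smul, add_assoc]
  have e3 : L.curveDeriv x 3 =ᶠ[𝓝 0] fun t ↦ (3 : ℝ) • Y₂ t + t • Y₃ t := by
    refine (nabla_congr e2).trans ((key2 ((SmoothGerm.const 2).smul hY₁) hY₂).trans ?_)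
    filter_upwards [h₂, h₃, hY₁.eventually_differentiableAt] with t ht ht' hd
    rw [← ht', nabla_smul (differentiableAt_const _) hd, ← ht, deriv_const]
    module
  refine ⟨?_, ?_, ?_, ?_⟩
  · filter_upwards [e0, e1] with t a b
    rw [area, a, b]
    simp only [area, PiLp.add_apply, PiLp.smul_apply, smul_eq_mul]
    ring
  · filter_upwards [e0, e2] with t a b
    rw [area, a, b]
    simp only [area, PiLp.add_apply, PiLp.smul_apply, smul_eq_mul]
    ring
  · filter_upwards [e0, e3] with t a b
    rw [area, a, b]
    simp only [area, PiLp.add_apply, PiLp.smul_apply, smul_eq_mul]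
    ring
  · filter_upwards [e1, e2] with t a b
    rw [area, a, b]
    simp only [area, PiLp.add_apply, PiLp.smul_apply, smul_eq_mul]
    ring

end PlanarEquiAffine

/-! ### Arclength and normalized curvature near the cusp. -/

namespace EquiAffineStructure

variable {M : Type*} [TopologicalSpace M] [ChartedSpace Plane M]
  [IsManifold (𝓡 2) ∞ M] (S : EquiAffineStructure M)

/-- The integrand is `|r| ^ (2/3) * u r`; rescaling to the unit interval extracts the non-smooth
factor and leaves a smooth average. -/
theorem affineArclength_eventuallyEq {γ : ℝ → M} {w u : ℝ → ℝ}
    (h01 : S.bracket γ 0 1 =ᶠ[𝓝 0] fun t ↦ t ^ 2 * w t)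
    (hu0 : ∀ᶠ t in 𝓝 0, 0 < u t) (hwu : ∀ᶠ t in 𝓝 (0 : ℝ), |w t| = u t ^ 3) :
    S.affineArclength γ =ᶠ[𝓝 0]
      fun t ↦ t * |t| ^ (2 / 3 : ℝ) * weightedAverage (2 / 3) u t := by
  obtain ⟨ε, hε, hb⟩ := Metric.eventually_nhds_iff.1 (h01.and (hu0.and hwu))
  refine Metric.eventually_nhds_iff.2 ⟨ε, hε, fun t ht ↦ ?_⟩
  simp only [affineArclength, weightedAverage]
  rw [integral_eq_smul_integral, smul_eq_mul, mul_assoc]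
  rw [← intervalIntegral.integral_const_mul (|t| ^ (2 / 3 : ℝ))]
  congr 1
  refine intervalIntegral.integral_congr fun r hr ↦ ?_
  rw [Set.uIcc_of_le zero_le_one] at hr
  have hrt : dist (r * t) 0 < ε := by
    rw [Real.dist_0_eq_abs] at ht ⊢
    rw [abs_mul, abs_of_nonneg hr.1]
    exact (mul_le_of_le_one_left (abs_nonneg t) hr.2).trans_lt ht
  obtain ⟨h1, h2, h3⟩ := hb hrt
  simp only [smul_eq_mul]
  rw [h1, abs_mul, h3, Real.mul_rpow (abs_nonneg _) (by positivity), ← Real.rpow_natCast (u (r * t)),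
    ← Real.rpow_mul h2.le, abs_pow, ← Real.rpow_natCast |r * t|, ← Real.rpow_mul (abs_nonneg _),
    abs_mul, abs_of_nonneg hr.1, Real.mul_rpow hr.1 (abs_nonneg _)]
  norm_num
  ring

theorem normalizedCurvature_eventuallyEq {γ : ℝ → M} {w dw A B u : ℝ → ℝ}
    (h01 : S.bracket γ 0 1 =ᶠ[𝓝 0] fun t ↦ t ^ 2 * w t)
    (h02 : S.bracket γ 0 2 =ᶠ[𝓝 0] fun t ↦ 2 * t * w t + t ^ 2 * dw t)
    (h03 : S.bracket γ 0 3 =ᶠ[𝓝 0] fun t ↦ 3 * t * dw t + t ^ 2 * A t)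
    (h12 : S.bracket γ 1 2 =ᶠ[𝓝 0] fun t ↦ 2 * w t + t * dw t + t ^ 2 * B t)
    (hu : ContDiff ℝ ∞ u) (hu0 : 0 < u 0) (hwu : ∀ᶠ t in 𝓝 (0 : ℝ), |w t| = u t ^ 3)
    {F : ℝ → ℝ} (hF : ContinuousAt F 0)
    (hFe : F =ᶠ[𝓝 0] fun t ↦ weightedAverage (2 / 3) u t ^ 2 * (4 * w t ^ 2 + t * w t * dw t +
      t ^ 2 * (3 * w t * A t + 12 * w t * B t - 5 * dw t ^ 2)) / (9 * u t ^ 8)) :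
    S.normalizedCurvature γ =ᶠ[𝓝 0] F := by
  have hup : ∀ᶠ t in 𝓝 (0 : ℝ), 0 < u t :=
    hu.continuous.continuousAt.eventually (lt_mem_nhds hu0)
  have key : ∀ᶠ t in 𝓝[≠] (0 : ℝ), S.affineArclength γ t ^ 2 * S.affineCurvature γ t = F t := by
    have := S.affineArclength_eventuallyEq h01 hup hwu
    filter_upwards [nhdsWithin_le_nhds this, nhdsWithin_le_nhds h01, nhdsWithin_le_nhds h02,
      nhdsWithin_le_nhds h03, nhdsWithin_le_nhds h12, nhdsWithin_le_nhds hup,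
      nhdsWithin_le_nhds hwu, nhdsWithin_le_nhds hFe, self_mem_nhdsWithin]
      with t e a1 a2 a3 a4 a5 a6 a7 a8
    have ht : 0 < |t| := abs_pos.2 a8
    -- With the cube root `p` of `|t|`, the fractional powers become natural ones and the
    -- cancellation is field arithmetic.
    obtain ⟨p, hp, hpt⟩ : ∃ p : ℝ, 0 < p ∧ |t| = p ^ 3 :=
      ⟨|t| ^ (1 / 3 : ℝ), by positivity, by
        rw [← Real.rpow_natCast, ← Real.rpow_mul ht.le]; norm_num⟩
    have hpow : ∀ {c : ℝ} (n : ℕ), 0 < c → (c ^ 3) ^ ((n : ℝ) / 3) = c ^ n := fun {c} n hc ↦ by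
      rw [← Real.rpow_natCast, ← Real.rpow_natCast, ← Real.rpow_mul hc.le]
      congr 1
      push_cast
      ring
    have h1 : |t| ^ (2 / 3 : ℝ) = p ^ 2 := by
      rw [hpt]; exact_mod_cast hpow 2 hp
    have ht2 : t ^ 2 = p ^ 6 := by rw [← sq_abs, hpt]; ring
    have h2 : |t ^ 2 * w t| ^ (8 / 3 : ℝ) = (p ^ 2 * u t) ^ 8 := by
      rw [abs_mul, a6, abs_pow, hpt, show (p ^ 3) ^ 2 * u t ^ 3 = (p ^ 2 * u t) ^ 3 by ring]
      exact_mod_cast hpow 8 (by positivity)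
    rw [e, affineCurvature, a1, a2, a3, a4, a7, h1, h2,
      show 3 * (t ^ 2 * w t) * (3 * t * dw t + t ^ 2 * A t) +
        12 * (t ^ 2 * w t) * (2 * w t + t * dw t + t ^ 2 * B t) -
        5 * (2 * t * w t + t ^ 2 * dw t) ^ 2 = t ^ 2 * (4 * w t ^ 2 + t * w t * dw t +
      t ^ 2 * (3 * w t * A t + 12 * w t * B t - 5 * dw t ^ 2)) by ring, mul_pow, mul_pow, ht2]
    field_simp
  have hlim : limUnder (𝓝[≠] (0 : ℝ)) (fun t ↦ S.affineArclength γ t ^ 2 * S.affineCurvature γ t) =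
      F 0 := by
    refine Tendsto.limUnder_eq ?_
    exact (hF.tendsto.mono_left nhdsWithin_le_nhds).congr' (key.mono fun _ h ↦ h.symm)
  filter_upwards [eventually_nhdsWithin_iff.1 key] with t ht
  by_cases h : t = 0
  · subst h
    simp [normalizedCurvature, hlim]
  · simp [normalizedCurvature, h, ht h]

end EquiAffineStructure

/-- The normalized curvature function of a 3/2-cusp has prescribed `1`-jet. -/
theorem cuspCurvature_oneJet {w dw E u : ℝ → ℝ} (hw : SmoothGerm w) (hdw : SmoothGerm dw)
    (hE : SmoothGerm E) (hu : ContDiff ℝ ∞ u) (hu0 : 0 < u 0)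
    (hwu : ∀ᶠ t in 𝓝 (0 : ℝ), |w t| = u t ^ 3) (hdw0 : dw 0 = deriv w 0) {F : ℝ → ℝ}
    (hF : F = fun t ↦ weightedAverage (2 / 3) u t ^ 2 *
      (4 * w t ^ 2 + t * w t * dw t + t ^ 2 * E t) / (9 * u t ^ 8)) :
    SmoothGerm F ∧ F 0 = 4 / 25 ∧ deriv F 0 = 0 := by
  have hσ : ContDiff ℝ ∞ (weightedAverage (2 / 3) u) := contDiff_weightedAverage (by norm_num) hu
  have hσ0 : weightedAverage (2 / 3) u 0 = 3 / 5 * u 0 := by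
    rw [weightedAverage_zero_right (by norm_num), smul_eq_mul]
    norm_num
  have hσ1 : HasDerivAt (weightedAverage (2 / 3) u) (3 / 8 * deriv u 0) 0 := by
    have := hasDerivAt_weightedAverage (a := 2 / 3) (by norm_num) hu 0
    rw [weightedAverage_zero_right (by norm_num), smul_eq_mul] at this
    rwa [show (2 / 3 + 1 + 1 : ℝ)⁻¹ = 3 / 8 by norm_num] at this
  have hwu2 : (fun t ↦ w t ^ 2) =ᶠ[𝓝 0] fun t ↦ u t ^ 6 := by
    filter_upwards [hwu] with t ht
    rw [← sq_abs, ht]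
    ring
  have hw0 : w 0 ^ 2 = u 0 ^ 6 := hwu2.eq_of_nhds
  have hu1 : HasDerivAt u (deriv u 0) 0 := (hu.differentiable (by simp) 0).hasDerivAt
  have hw1 : HasDerivAt w (deriv w 0) 0 := hw.differentiableAt.hasDerivAt
  have hww : w 0 * deriv w 0 = 3 * u 0 ^ 5 * deriv u 0 := by
    -- Differentiating `w ^ 2 = u ^ 6` avoids choosing a sign for `w`.
    have h1 := ((hw1.pow 2).congr_of_eventuallyEq hwu2.symm).unique (hu1.pow 6)
    norm_num at h1
    linarith
  have hN : HasDerivAt (fun t ↦ 4 * w t ^ 2 + t * w t * dw t + t ^ 2 * E t)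
      (27 * u 0 ^ 5 * deriv u 0) 0 := by
    have h1 := (((hw1.pow 2).const_mul 4).add
      (((hasDerivAt_id (0 : ℝ)).mul hw1).mul hdw.differentiableAt.hasDerivAt)).add
      (((hasDerivAt_id (0 : ℝ)).pow 2).mul hE.differentiableAt.hasDerivAt)
    refine h1.congr_deriv ?_
    simp only [id, hdw0]
    norm_num
    -- `4 * w ^ 2` contributes `8 * w * w'` and `t * w * dw` contributes one more, because `dw 0 =
    -- w' 0`.
    linear_combination 9 * hww
  have hne : (9 * u 0 ^ 8 : ℝ) ≠ 0 := by positivity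
  subst hF
  refine ⟨?_, ?_, ?_⟩
  · exact SmoothGerm.div ((hσ.smoothGerm.pow 2).mul ((((SmoothGerm.const 4).mul (hw.pow 2)).add
      ((SmoothGerm.id.mul hw).mul hdw)).add ((SmoothGerm.id.pow 2).mul hE)))
      ((SmoothGerm.const 9).mul (hu.smoothGerm.pow 8)) hne
  · simp only [hσ0, hw0]
    field_simp
    ring
  · have h1 := ((hσ1.pow 2).mul hN).div ((hu1.pow 8).const_mul 9) hne
    refine Eq.trans (HasDerivAt.deriv h1) ?_
    simp only [Pi.mul_apply, Pi.pow_apply, hσ0, hw0]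
    field_simp
    ring

/-! ### Construction of a cusp by an ordinary differential equation. -/

/-- Picard–Lindelöf yields a differentiable solution. On a smaller interval it stays in `V`, and
there the equation itself makes it smooth. -/
theorem exists_smoothGerm_hasDerivAt {E : Type*} [NormedAddCommGroup E] [NormedSpace ℝ E]
    [CompleteSpace E] {V : Set E} (hV : IsOpen V) {f : E → E} (hf : ContDiffOn ℝ ∞ f V) {x₀ : E}
    (h0 : x₀ ∈ V) :
    ∃ α : ℝ → E, SmoothGerm α ∧ α 0 = x₀ ∧ ∀ᶠ t in 𝓝 (0 : ℝ), HasDerivAt α (f (α t)) t := by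
  obtain ⟨α, hα0, ε, hε, hα⟩ :=
    ((hf.contDiffAt (hV.mem_nhds h0)).of_le
      (by simp)).exists_forall_mem_closedBall_exists_eq_forall_mem_Ioo_hasDerivAt₀ 0
  have hd : ∀ᶠ t in 𝓝 (0 : ℝ), HasDerivAt α (f (α t)) t :=
    eventually_of_mem (Ioo_mem_nhds (by linarith) (by linarith)) hα
  have hc : ContinuousAt α 0 := hd.self_of_nhds.continuousAt
  obtain ⟨δ, hδ, hb⟩ := Metric.eventually_nhds_iff.1
    (hd.and (hc.eventually (hV.mem_nhds (by rwa [hα0]))))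
  have hI : ∀ t ∈ Set.Icc (-(δ / 2)) (δ / 2), dist t 0 < δ := fun t ht ↦ by
    rw [Real.dist_0_eq_abs]
    exact (abs_le.2 ht).trans_lt (by linarith)
  have hs : ContDiffOn ℝ ∞ α (Set.Icc (-(δ / 2)) (δ / 2)) :=
    ODE.contDiffOn_enat_Icc_of_hasDerivWithinAt (f := fun _ ↦ f) (u := V) (n := ⊤)
      (hf.comp contDiff_snd.contDiffOn fun z hz ↦ hz.2)
      (fun t ht ↦ (hb (hI t ht)).1.hasDerivWithinAt) fun t ht ↦ (hb (hI t ht)).2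
  refine ⟨α, ?_, hα0, hd⟩
  filter_upwards [Ioo_mem_nhds (show -(δ / 2) < 0 by linarith) (show 0 < δ / 2 by linarith)]
    with t ht
  exact hs.contDiffAt (Icc_mem_nhds ht.1 ht.2)

theorem HasDerivAt.prod_fst {E F : Type*} [NormedAddCommGroup E] [NormedSpace ℝ E]
    [NormedAddCommGroup F] [NormedSpace ℝ F] {α : ℝ → E × F} {a : E × F} {t : ℝ}
    (h : HasDerivAt α a t) : HasDerivAt (fun t ↦ (α t).1) a.1 t :=
  (ContinuousLinearMap.fst ℝ E F).hasFDerivAt.comp_hasDerivAt t h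

theorem HasDerivAt.prod_snd {E F : Type*} [NormedAddCommGroup E] [NormedSpace ℝ E]
    [NormedAddCommGroup F] [NormedSpace ℝ F] {α : ℝ → E × F} {a : E × F} {t : ℝ}
    (h : HasDerivAt α a t) : HasDerivAt (fun t ↦ (α t).2) a.2 t :=
  (ContinuousLinearMap.snd ℝ E F).hasFDerivAt.comp_hasDerivAt t h

namespace PlanarEquiAffine

variable (L : PlanarEquiAffine)

/-- The correction term of the covariant derivative in coordinates. -/
noncomputable def conn (y ξ v : Plane) : Plane := ∑ i, ∑ j, (ξ i * v j) • L.Γ i j y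

theorem nabla_eq (x ξ : ℝ → Plane) (t : ℝ) :
    L.nabla x ξ t = deriv ξ t + L.conn (x t) (ξ t) (deriv x t) := rfl

theorem contDiffOn_conn {E : Type*} [NormedAddCommGroup E] [NormedSpace ℝ E] {V : Set E}
    {y ξ v : E → Plane} (hy : ContDiffOn ℝ ∞ y V) (hU : Set.MapsTo y V L.U)
    (hξ : ContDiffOn ℝ ∞ ξ V) (hv : ContDiffOn ℝ ∞ v V) :
    ContDiffOn ℝ ∞ (fun e ↦ L.conn (y e) (ξ e) (v e)) V := by
  have hc : ∀ {ζ : E → Plane}, ContDiffOn ℝ ∞ ζ V → ∀ i, ContDiffOn ℝ ∞ (fun e ↦ ζ e i) V :=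
    fun hζ i ↦ (EuclideanSpace.proj (𝕜 := ℝ) i : Plane →L[ℝ] ℝ).contDiff.comp_contDiffOn hζ
  exact ContDiffOn.sum fun i _ ↦ ContDiffOn.sum fun j _ ↦
    ((hc hξ i).mul (hc hv j)).smul ((L.smooth_Γ i j).comp hy hU)

/-- There are curves `x` with velocity `t ↦ t • Y t` such that `∇∇Y = -q Y` and `[Y, ∇Y] = 1`. -/
theorem exists_curve_of_potential {x₀ : Plane} (h0 : x₀ ∈ L.U) {q : ℝ → ℝ}
    (hq : ContDiff ℝ ∞ q) :
    ∃ x Y Z : ℝ → Plane, SmoothGerm x ∧ SmoothGerm Y ∧ SmoothGerm Z ∧ x 0 = x₀ ∧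
      (deriv x =ᶠ[𝓝 0] fun t ↦ t • Y t) ∧ Z =ᶠ[𝓝 0] L.nabla x Y ∧
      ((fun t ↦ -q t • Y t) =ᶠ[𝓝 0] L.nabla x Z) ∧ L.area x Y Z =ᶠ[𝓝 0] fun _ ↦ 1 := by
  let E := Plane × Plane × Plane × ℝ
  let V : Set E := {e | e.1 ∈ L.U}
  have hV : IsOpen V := L.isOpen_U.preimage continuous_fst
  -- The state is `(x, Y, Z, τ)`; the clock `τ` with `τ' = 1` makes the system autonomous.
  let f : E → E := fun e ↦ (e.2.2.2 • e.2.1,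
    e.2.2.1 - L.conn e.1 e.2.1 (e.2.2.2 • e.2.1),
    -q e.2.2.2 • e.2.1 - L.conn e.1 e.2.2.1 (e.2.2.2 • e.2.1), 1)
  have h1 : ContDiff ℝ ∞ fun e : E ↦ e.1 := contDiff_fst
  have h2 : ContDiff ℝ ∞ fun e : E ↦ e.2.1 := contDiff_fst.comp contDiff_snd
  have h3 : ContDiff ℝ ∞ fun e : E ↦ e.2.2.1 := contDiff_fst.comp (contDiff_snd.comp contDiff_snd)
  have h4 : ContDiff ℝ ∞ fun e : E ↦ e.2.2.2 := contDiff_snd.comp (contDiff_snd.comp contDiff_snd)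
  have hU : Set.MapsTo (fun e : E ↦ e.1) V L.U := fun _ h ↦ h
  have hf : ContDiffOn ℝ ∞ f V :=
    (h4.smul h2).contDiffOn.prodMk <|
      (h3.contDiffOn.sub (L.contDiffOn_conn h1.contDiffOn hU h2.contDiffOn
        (h4.smul h2).contDiffOn)).prodMk <|
      (((hq.comp h4).neg.smul h2).contDiffOn.sub (L.contDiffOn_conn h1.contDiffOn hU
        h3.contDiffOn (h4.smul h2).contDiffOn)).prodMk contDiffOn_const
  obtain ⟨α, hα, hα0, hαd⟩ := exists_smoothGerm_hasDerivAt hV hf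
    -- The second vector is divided by the density so that `[Y, Z] = 1` at `0`. This persists since
    -- the derivative of `[Y, Z]` is `[Z, Z] + [Y, -q Y] = 0`.
    (x₀ := (x₀, EuclideanSpace.single 0 1, (L.dens x₀)⁻¹ • EuclideanSpace.single 1 1, 0)) h0
  have hτ : (fun t ↦ (α t).2.2.2) =ᶠ[𝓝 0] fun t ↦ t := by
    refine SmoothGerm.eventuallyEq_of_deriv_eq
      (hα.mono fun t h ↦ h4.contDiffAt.comp t h) SmoothGerm.id ?_ (by rw [hα0])
    filter_upwards [hαd] with t ht
    rw [ht.prod_snd.prod_snd.prod_snd.deriv, deriv_id'']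
  have hx : SmoothGerm fun t ↦ (α t).1 := hα.mono fun t h ↦ h1.contDiffAt.comp t h
  have hY : SmoothGerm fun t ↦ (α t).2.1 := hα.mono fun t h ↦ h2.contDiffAt.comp t h
  have hZ : SmoothGerm fun t ↦ (α t).2.2.1 := hα.mono fun t h ↦ h3.contDiffAt.comp t h
  have hxd : deriv (fun t ↦ (α t).1) =ᶠ[𝓝 0] fun t ↦ t • (α t).2.1 := by
    filter_upwards [hαd, hτ] with t ht h
    rw [ht.prod_fst.deriv]
    simp only [f, h]
  have hYd : (fun t ↦ (α t).2.2.1) =ᶠ[𝓝 0] L.nabla (fun t ↦ (α t).1) (fun t ↦ (α t).2.1) := by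
    filter_upwards [hαd, hτ, hxd] with t ht h h'
    rw [nabla_eq, h', ht.prod_snd.prod_fst.deriv]
    simp only [f, h, sub_add_cancel]
  have hZd : (fun t ↦ -q t • (α t).2.1) =ᶠ[𝓝 0]
      L.nabla (fun t ↦ (α t).1) (fun t ↦ (α t).2.2.1) := by
    filter_upwards [hαd, hτ, hxd] with t ht h h'
    rw [nabla_eq, h', ht.prod_snd.prod_snd.prod_fst.deriv]
    simp only [f, h, sub_add_cancel]
  refine ⟨_, _, _, hx, hY, hZ, by rw [hα0], hxd, hYd, hZd, ?_⟩
  refine (smoothGerm_area hx (by simpa only [hα0] using h0) hY hZ).eventuallyEq_of_deriv_eq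
    (SmoothGerm.const 1) ?_ ?_
  · filter_upwards [hx.eventually_differentiableAt, hY.eventually_differentiableAt,
      hZ.eventually_differentiableAt, hYd, hZd,
      hx.continuousAt.eventually (L.isOpen_U.mem_nhds (by simpa only [hα0] using h0))]
      with t a b c d e g
    rw [(hasDerivAt_area a g b c).deriv, deriv_const]
    simp only [area, ← d, ← e, PiLp.smul_apply, smul_eq_mul]
    ring
  · simp [area, hα0, L.dens_ne_zero _ h0]

end PlanarEquiAffine

theorem PlanarEquiAffine.nabla_of_deriv_eq_zero {L : PlanarEquiAffine} {x ξ : ℝ → Plane} {t : ℝ}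
    (h : deriv x t = 0) : L.nabla x ξ t = deriv ξ t := by
  simp [PlanarEquiAffine.nabla, h]

/-! ### The two inclusions. -/

namespace EquiAffineStructure

variable {M : Type*} [TopologicalSpace M] [T2Space M] [ChartedSpace Plane M]
  [IsManifold (𝓡 2) ∞ M] (S : EquiAffineStructure M)

theorem normalizedCurvature_of_cusp {γ : ℝ → M} (h : IsThreeHalvesCusp γ) :
    ∃ f : ℝ → ℝ, S.normalizedCurvature γ =ᶠ[𝓝 0] f ∧ SmoothGerm f ∧ f 0 = 4 / 25 ∧
      deriv f 0 = 0 := by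
  obtain ⟨Y, hY, hxY, hdet⟩ := h.exists_deriv_eq
  obtain ⟨L, hL, -, hbr⟩ := S.exists_planarEquiAffine (γ 0)
  replace hbr := hbr γ h.1 rfl
  set x : ℝ → Plane := fun t ↦ extChartAt (𝓡 2) (γ 0) (γ t) with hx'
  have hx : SmoothGerm x := by
    have hs := h.1.self_of_nhds.continuousAt.eventually
      ((chartAt Plane (γ 0)).open_source.mem_nhds (mem_chart_source _ _))
    filter_upwards [h.1, hs] with t h1 h2
    exact ((contMDiffAt_extChartAt' h2).comp t h1).contDiffAt
  have hxU : x 0 ∈ L.U := hL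
  have hY₁ := PlanarEquiAffine.smoothGerm_nabla hx hxU hY
  have hY₂ := PlanarEquiAffine.smoothGerm_nabla hx hxU hY₁
  have hY₃ := PlanarEquiAffine.smoothGerm_nabla hx hxU hY₂
  obtain ⟨h01, h02, h03, h12⟩ := PlanarEquiAffine.area_curveDeriv_of_deriv_eq hx hxU hY hxY
    EventuallyEq.rfl EventuallyEq.rfl EventuallyEq.rfl
  have hw := PlanarEquiAffine.smoothGerm_area hx hxU hY hY₁
  have hdw := PlanarEquiAffine.smoothGerm_area hx hxU hY hY₂
  have hA := PlanarEquiAffine.smoothGerm_area hx hxU hY hY₃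
  have hB := PlanarEquiAffine.smoothGerm_area hx hxU hY₁ hY₂
  -- The velocity vanishes at the cusp, so `∇Y` is the ordinary derivative there and the
  -- independence condition applies.
  have hw0 : L.area x Y (L.nabla x Y) 0 ≠ 0 := by
    have : deriv x 0 = 0 := by rw [hxY.eq_of_nhds, zero_smul]
    rw [PlanarEquiAffine.area, PlanarEquiAffine.nabla_of_deriv_eq_zero this]
    exact mul_ne_zero (L.dens_ne_zero _ hxU) hdet
  have hdw0 : L.area x Y (L.nabla x (L.nabla x Y)) 0 = deriv (L.area x Y (L.nabla x Y)) 0 := by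
    rw [(PlanarEquiAffine.hasDerivAt_area hx.differentiableAt hxU hY.differentiableAt
      hY₁.differentiableAt).deriv, PlanarEquiAffine.area_self, zero_add]
  have hu' : SmoothGerm fun t ↦ |L.area x Y (L.nabla x Y) t| ^ (1 / 3 : ℝ) := by
    filter_upwards [hw, hw.continuousAt.eventually_ne hw0] with t h1 h2
    exact (h1.abs h2).rpow_const_of_ne (abs_ne_zero.2 h2)
  obtain ⟨u, hu, hue⟩ := hu'.exists_contDiff
  have hu0 : 0 < u 0 := by
    rw [hue.eq_of_nhds]
    have := abs_pos.2 hw0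
    positivity
  have hwu : ∀ᶠ t in 𝓝 (0 : ℝ), |L.area x Y (L.nabla x Y) t| = u t ^ 3 := by
    filter_upwards [hue] with t ht
    rw [ht, ← Real.rpow_natCast, ← Real.rpow_mul (abs_nonneg _)]
    norm_num
  obtain ⟨hF, hF0, hF1⟩ := cuspCurvature_oneJet hw hdw
    ((((((SmoothGerm.const 3).mul hw).mul hA).add (((SmoothGerm.const 12).mul hw).mul hB))).sub
      ((SmoothGerm.const 5).mul (hdw.pow 2))) hu hu0 hwu hdw0 rfl
  exact ⟨_, S.normalizedCurvature_eventuallyEq ((hbr 0 1).trans h01) ((hbr 0 2).trans h02)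
    ((hbr 0 3).trans h03) ((hbr 1 2).trans h12) hu hu0 hwu hF.continuousAt EventuallyEq.rfl,
    hF, hF0, hF1⟩

theorem exists_cusp_of_oneJet (p : M) {f : ℝ → ℝ} (hf : SmoothGerm f) (hf0 : f 0 = 4 / 25)
    (hf1 : deriv f 0 = 0) :
    ∃ γ : ℝ → M, IsThreeHalvesCusp γ ∧ S.normalizedCurvature γ =ᶠ[𝓝 0] f := by
  obtain ⟨g, hg, hfg, hg0⟩ := (hf.sub (SmoothGerm.const (4 / 25))).exists_eq_smul
    (by rw [hf0, sub_self])
  rw [deriv_sub_const, hf1] at hg0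
  obtain ⟨k, hk, hgk, -⟩ := hg.exists_eq_smul hg0
  -- The constant inverts the factor `9/25` of `t ^ 2 * q` in the normalized curvature when `w = 1`.
  obtain ⟨q, hq, hqk⟩ := ((SmoothGerm.const (25 / 9)).mul hk).exists_contDiff
  obtain ⟨L, hL, hLt, hbr⟩ := S.exists_planarEquiAffine p
  obtain ⟨x, Y, Z, hx, hY, hZ, hx0, hxY, hYZ, hZY, hw⟩ := L.exists_curve_of_potential hL hq
  have hxU : x 0 ∈ L.U := hx0 ▸ hL
  let γ : ℝ → M := fun t ↦ (extChartAt (𝓡 2) p).symm (x t)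
  have hγ0 : γ 0 = p := by simp only [γ, hx0, extChartAt_to_inv]
  have hxt : ∀ᶠ t in 𝓝 (0 : ℝ), x t ∈ (extChartAt (𝓡 2) p).target :=
    hx.continuousAt.eventually ((isOpen_extChartAt_target p).mem_nhds (hLt hxU))
  have hγ : ∀ᶠ t in 𝓝 (0 : ℝ), ContMDiffAt 𝓘(ℝ, ℝ) (𝓡 2) ∞ γ t := by
    filter_upwards [hx, hxt] with t h1 h2
    exact ((contMDiffOn_extChartAt_symm p).contMDiffAt
      ((isOpen_extChartAt_target p).mem_nhds h2)).comp t h1.contMDiffAt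
  have hγx : (fun t ↦ extChartAt (𝓡 2) p (γ t)) =ᶠ[𝓝 0] x := by
    filter_upwards [hxt] with t ht
    exact (extChartAt (𝓡 2) p).right_inv ht
  have hdx : deriv x 0 = 0 := by rw [hxY.eq_of_nhds, zero_smul]
  have hdet : det₂ (Y 0) (deriv Y 0) ≠ 0 := by
    rw [← PlanarEquiAffine.nabla_of_deriv_eq_zero (L := L) hdx, ← hYZ.eq_of_nhds]
    intro h
    have : L.dens (x 0) * det₂ (Y 0) (Z 0) = 1 := hw.eq_of_nhds
    rw [h, mul_zero] at this
    exact zero_ne_one this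
  refine ⟨γ, isThreeHalvesCusp_of_deriv_eq hγ (by rw [hγ0]; exact hγx) hx hY hxY hdet, ?_⟩
  replace hbr := hbr γ hγ hγ0
  set X : ℝ → Plane := fun t ↦ extChartAt (𝓡 2) p (γ t)
  have hXn : ∀ {t}, X =ᶠ[𝓝 t] x → ∀ ξ, L.nabla X ξ t = L.nabla x ξ t := fun h ξ ↦ by
    simp only [PlanarEquiAffine.nabla, h.deriv_eq, h.eq_of_nhds]
  have hn : ∀ ξ, L.nabla X ξ =ᶠ[𝓝 0] L.nabla x ξ := fun ξ ↦ by
    filter_upwards [hγx.eventually_nhds] with t ht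
    exact hXn ht ξ
  have hX : SmoothGerm X := hx.congr hγx.symm
  have hXU : X 0 ∈ L.U := by rw [hγx.eq_of_nhds]; exact hxU
  obtain ⟨h01, h02, h03, h12⟩ := PlanarEquiAffine.area_curveDeriv_of_deriv_eq
    (Y₃ := fun t ↦ -deriv q t • Y t + -q t • Z t) hX hXU hY
    (hγx.deriv.trans hxY) (hYZ.trans (hn Y).symm) (hZY.trans (hn Z).symm) (by
      filter_upwards [hn (fun t ↦ -q t • Y t), hY.eventually_differentiableAt, hYZ] with t h1 h2 h3
      have hqd : DifferentiableAt ℝ (fun t ↦ -q t) t := (hq.differentiable (by simp) t).neg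
      rw [h1, PlanarEquiAffine.nabla_smul hqd h2, ← h3, deriv.fun_neg])
  have hXw : L.area X Y Z =ᶠ[𝓝 0] fun _ ↦ 1 := by
    filter_upwards [hw, hγx] with t h1 h2
    rw [PlanarEquiAffine.area, h2]
    exact h1
  -- From `∇Z = -q Y` and `[Y, Z] = 1`: `[Y, ∇∇Y] = 0`, `[Y, ∇∇∇Y] = -q` and `[∇Y, ∇∇Y] = q`. Hence
  -- the coefficient of `t ^ 2` is `-3q + 12q = 9q`.
  refine S.normalizedCurvature_eventuallyEq (w := fun _ ↦ 1) (dw := fun _ ↦ 0) (A := fun t ↦ -q t)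
    (B := q) (u := fun _ ↦ 1) ?_ ?_ ?_ ?_ contDiff_const one_pos (by simp) hf.continuousAt ?_
  · filter_upwards [(hbr 0 1).trans h01, hXw] with t h1 h2
    rw [h1, h2]
  · filter_upwards [(hbr 0 2).trans h02, hXw] with t h1 h2
    rw [h1, h2]
    simp only [PlanarEquiAffine.area, PiLp.smul_apply, smul_eq_mul]
    ring
  · filter_upwards [(hbr 0 3).trans h03, hXw] with t h1 h2
    rw [h1]
    simp only [PlanarEquiAffine.area, PiLp.smul_apply, PiLp.add_apply, smul_eq_mul] at h2 ⊢
    linear_combination (-t ^ 2 * q t) * h2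
  · filter_upwards [(hbr 1 2).trans h12, hXw] with t h1 h2
    rw [h1, h2]
    simp only [PlanarEquiAffine.area, PiLp.smul_apply, smul_eq_mul] at h2 ⊢
    linear_combination (t ^ 2 * q t) * h2
  · have hσ : ∀ t, weightedAverage (2 / 3) (fun _ ↦ (1 : ℝ)) t = 3 / 5 := fun t ↦ by
      have := weightedAverage_zero_right (a := 2 / 3) (by norm_num) fun _ : ℝ ↦ (1 : ℝ)
      rw [smul_eq_mul] at this
      exact this.trans (by norm_num)
    filter_upwards [hfg, hgk, hqk] with t h1 h2 h3
    rw [h2, smul_eq_mul, smul_eq_mul] at h1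
    rw [hσ, h3]
    linear_combination h1

end EquiAffineStructure

theorem corollary3p9 {M : Type*} [TopologicalSpace M] [T2Space M] [Nonempty M]
    [ChartedSpace Plane M] [IsManifold (𝓡 2) ∞ M] (S : EquiAffineStructure M) :
    S.normalizedCurvatureGerm '' cuspGerms M =
      {φ : Germ (𝓝 (0 : ℝ)) ℝ | ∃ f : ℝ → ℝ, (f : Germ (𝓝 (0 : ℝ)) ℝ) = φ ∧
        (∀ᶠ t in 𝓝 (0 : ℝ), ContDiffAt ℝ ∞ f t) ∧ f 0 = 4 / 25 ∧ deriv f 0 = 0} := by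
  ext φ
  constructor
  · rintro ⟨_, ⟨γ, hγ, rfl⟩, rfl⟩
    obtain ⟨f, hf, hfs, hf0, hf1⟩ := S.normalizedCurvature_of_cusp hγ
    exact ⟨f, (Germ.coe_eq.2 hf).symm, hfs, hf0, hf1⟩
  · rintro ⟨f, rfl, hf, hf0, hf1⟩
    obtain ⟨p⟩ := ‹Nonempty M›
    obtain ⟨γ, hγ, hγf⟩ := S.exists_cusp_of_oneJet p hf hf0 hf1
    exact ⟨_, ⟨γ, hγ, rfl⟩, Germ.coe_eq.2 hγf⟩
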